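/- For $r\ge 2$, an $r$-graph is a finite vertex set together with a collection of $r$-element subsets of it, called edges; $|H|$ denotes the number of edges of $H$. An $r$-graph $H$ is $F$-free if it does not contain $F$ as a (not necessarily induced) subgraph; $\mathrm{ex}(n,F)$ is the maximum of $|H|$ over all $F$-free $r$-graphs $H$ on $n$ vertices, and $\pi(F)=\lim_{n\to\infty}\mathrm{ex}(n,F)/\binom nr$. Call $F$ $t$-stable if for every $m\in\mathbb N$ there exist $r$-graphs $G_1(m),\dots,G_t(m)$ on $m$ vertices such that for every $\delta>0$ there exist $\varepsilon>0$ and $N_0$ with the following property: whenever $n\ge N_0$ and $H$ is an $F$-free $r$-graph on $n$ vertices with $|H|>(1-\varepsilon)\,\mathrm{ex}(n,F)$, then, after relabelling its vertices, $H$ can be transformed into some $G_i(n)$ by adding and deleting at most $\delta n^r$ edges. The stability number $\xi(F)$ is the least $t$ for which $F$ is $t$-stable, and $\xi(F)=\infty$ if there is no such $t$. The categorical product $G\times H$ of two $3$-graphs has vertex set $V(G)\times V(H)$, and a triple $\{(x_1,y_1),(x_2,y_2),(x_3,y_3)\}$ is an edge of it if and only if $\{x_1,x_2,x_3\}$ is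 an edge of $G$ and $\{y_1,y_2,y_3\}$ is an edge of $H$. **Theorem 1.** Let $K_4^-=\{abc,abd,acd\}$ be the $3$-graph on the vertex set $\{a,b,c,d\}$, let $F^\star=\{123,124,345,156,257\}$ be the $3$-graph on the vertex set $\{1,\dots,7\}$, and let $F=K_4^-\times F^\star$. Then $F$ has $28$ vertices and $90$ edges, the limit $\pi(F)$ exists and equals $\frac29$, and $\xi(F)=\infty$. -/

import Mathlib

open Filter Topology

/-- An `r`-uniform hypergraph (`r`-graph) with vertex set the type `V`: a finite collection of
`r`-element subsets of `V`. -/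
@[ext]
structure RGraph (r : ℕ) (V : Type*) where
  /-- The edges. -/
  edges : Finset (Finset V)
  /-- Every edge has exactly `r` vertices. -/
  card_eq : ∀ e ∈ edges, e.card = r

namespace RGraph

variable {r : ℕ} {V W : Type*}

/-- The categorical product: an `r`-set of pairs is an edge if and only if its two coordinate
projections are both edges. -/
def prod [Fintype V] [Fintype W] [DecidableEq V] [DecidableEq W]
    (G : RGraph r V) (H : RGraph r W) : RGraph r (V × W) where
  edges := (Finset.powersetCard r Finset.univ).filter
    fun e => e.image Prod.fst ∈ G.edges ∧ e.image Prod.snd ∈ H.edges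
  card_eq := fun _ he => (Finset.mem_powersetCard.mp (Finset.mem_filter.mp he).1).2

/-- `H` contains a copy of `F` as a (not necessarily induced) subgraph. -/
def Contains [DecidableEq V] (H : RGraph r V) (F : RGraph r W) : Prop :=
  ∃ f : W → V, Function.Injective f ∧ ∀ e ∈ F.edges, e.image f ∈ H.edges

/-- `H` is `F`-free. -/
def IsFree [DecidableEq V] (H : RGraph r V) (F : RGraph r W) : Prop :=
  ¬ H.Contains F

/-- The Turán number `ex(n, F)`: the maximum number of edges of an `F`-free `r`-graph on `n`
vertices. -/
noncomputable def turanNumber (n : ℕ) (F : RGraph r W) : ℕ :=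
  sSup {m : ℕ | ∃ H : RGraph r (Fin n), H.IsFree F ∧ H.edges.card = m}

/-- The Turán density `π(F) = lim ex(n, F) / (n choose r)` exists and equals `d`. -/
def HasTuranDensity (F : RGraph r W) (d : ℝ) : Prop :=
  Tendsto (fun n : ℕ => (turanNumber n F : ℝ) / (n.choose r : ℝ)) atTop (𝓝 d)

/-- The number of edges to be added or deleted in order to turn `H`, relabelled by the
permutation `σ` of its vertices, into `G`. -/
def editCount [DecidableEq V] (σ : Equiv.Perm V) (H G : RGraph r V) : ℕ :=
  (symmDiff (H.edges.image (Finset.image σ)) G.edges).card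

/-- `F` is `t`-stable: there are `t` models `G 0 m, …, G (t - 1) m` on `m` vertices, for every `m`,
such that every near-extremal `F`-free `r`-graph on `n` vertices is, after relabelling, within
`δ n ^ r` edge edits of one of the models on `n` vertices. -/
def IsStable (t : ℕ) (F : RGraph r W) : Prop :=
  ∃ G : Fin t → (m : ℕ) → RGraph r (Fin m),
    ∀ δ : ℝ, 0 < δ → ∃ ε : ℝ, 0 < ε ∧ ∃ N₀ : ℕ, ∀ n : ℕ, N₀ ≤ n →
      ∀ H : RGraph r (Fin n), H.IsFree F →
        (1 - ε) * (turanNumber n F : ℝ) < (H.edges.card : ℝ) →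
          ∃ (i : Fin t) (σ : Equiv.Perm (Fin n)),
            (editCount σ H (G i n) : ℝ) ≤ δ * (n : ℝ) ^ r

/-- The stability number `ξ(F)`: the least `t` such that `F` is `t`-stable, and `∞` if there is
no such `t`. -/
noncomputable def stabilityNumber (F : RGraph r W) : ℕ∞ :=
  sInf {s : ℕ∞ | ∃ t : ℕ, F.IsStable t ∧ s = (t : ℕ∞)}

end RGraph

/-- `K₄⁻ = {abc, abd, acd}`, with `a, b, c, d` written as `0, 1, 2, 3`. -/
def K4minus : RGraph 3 (Fin 4) where
  edges := {{0, 1, 2}, {0, 1, 3}, {0, 2, 3}}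
  card_eq := by decide +kernel

/-- `F⋆ = {123, 124, 345, 156, 257}`, with the vertices `1, …, 7` written as `0, …, 6`. -/
def FStar : RGraph 3 (Fin 7) where
  edges := {{0, 1, 2}, {0, 1, 3}, {2, 3, 4}, {0, 4, 5}, {1, 4, 6}}
  card_eq := by decide +kernel

/-- The `3`-graph `F = K₄⁻ × F⋆`. -/
def productF : RGraph 3 (Fin 4 × Fin 7) :=
  K4minus.prod FStar

/-!
# The `3`-graph `K₄⁻ × F⋆` has Turán density `2 / 9` and no finite stability number

**Upper bound.** Since `F = K₄⁻ × F⋆` projects onto both factors, a blow-up of either factor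
contains `F`. Hence a large `F`-free `3`-graph has few homomorphic copies of `K₄⁻` and of `F⋆`: this
is Erdős' argument that dense sets of tuples contain boxes (`RGraph.exists_injective_box`,
`RGraph.contains_of_many_homs`). Sampling boundedly many vertices reduces the bound to `3`-graphs
that receive no homomorphism from `K₄⁻` or `F⋆` at all (`RGraph.sum_adj_mul_le`), and these have
Lagrangian density at most `2 / 9` (`RGraph.triForm_le_two_ninths`). Indeed, in a maximizer of the
Lagrange polynomial with minimal support all pairs of the support are covered by edges inside the
support. In such a `3`-graph two edges sharing a pair would give `K₄⁻` or
`F₅ = {123, 124, 345}`, and `F₅` extends to `F⋆` because the pairs `15` and `25` are covered. So the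
edges in the support pairwise share at most one vertex, the link of the heaviest vertex is a
matching, and the first-order condition at that vertex gives the bound.

**Constructions.** Let `W ∪ U` be a vertex set with `|U| = 2 |W|`, and let the link of each `w ∈ W`
be a balanced complete bipartite graph on `U`. Whatever the bipartitions are, the edge density tends
to `2 / 9`. If all `w` use one of two bipartitions, the `3`-graph receives no homomorphism from `F`
(`not_isHom_productF_twoCuts`): the preimage of `W` meets every edge of `F` exactly once, and linear
algebra on the product of `K₄⁻` with an edge shows that it comes from one of the factors. It does
not come from `F⋆`, which has no set of vertices meeting each edge exactly once; so it is the row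
of the apex of `K₄⁻`, and then the copy of `F₅` in `F⋆` gives contradictory conditions on the two
bipartitions.

**Instability.** Take two independent bipartitions of `U`, used by `j` and `|W| - j` vertices. The
sum of the squared codegrees of these `3`-graphs depends on `j` in the leading order `n ^ 4`
(`sumSqCodegree_twoCuts`), while editing an edge changes it by `O(n)` (`sumSqCodegree_le`). So
`t + 1` suitable values of `j` give almost extremal `3`-graphs that are pairwise far apart, and two
of them would have to be close to the same one of `t` models.
-/

/-! ### Homomorphisms and the adjacency of a `3`-graph -/

namespace RGraph

/-- `f` is a homomorphism from `F` to `H`: it maps edges to edges. It need not be injective on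
vertices, but it is injective on every edge, because all edges have `r` elements. -/
def IsHom {r : ℕ} {V W : Type*} [DecidableEq V] (F : RGraph r W) (H : RGraph r V) (f : W → V) :
    Prop :=
  ∀ e ∈ F.edges, e.image f ∈ H.edges

section Adj

variable {V : Type*} [DecidableEq V] {G : RGraph 3 V}

lemma ne_of_mem_edges {i j k : V} (h : {i, j, k} ∈ G.edges) : i ≠ j ∧ i ≠ k ∧ j ≠ k :=
  Finset.card_triple_eq_three_iff.mp (G.card_eq _ h)

/-- The indicator of the ordered triples that span an edge of the `3`-graph `G`. -/
def adj (G : RGraph 3 V) (i j k : V) : ℝ := if {i, j, k} ∈ G.edges then 1 else 0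

lemma adj_nonneg (i j k : V) : 0 ≤ G.adj i j k := by
  unfold adj; split_ifs <;> norm_num

lemma adj_swap_left (i j k : V) : G.adj i j k = G.adj j i k := by
  unfold adj; rw [Finset.insert_comm]

lemma adj_swap_right (i j k : V) : G.adj i j k = G.adj i k j := by
  unfold adj; rw [Finset.pair_comm]

lemma adj_eq_zero {i j k : V} (h : {i, j, k} ∉ G.edges) : G.adj i j k = 0 := if_neg h

lemma adj_self_left (i k : V) : G.adj i i k = 0 :=
  adj_eq_zero fun h => (ne_of_mem_edges h).1 rfl

lemma isHom_K4minus {a b c d : V} (h₁ : {a, b, c} ∈ G.edges) (h₂ : {a, b, d} ∈ G.edges)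
    (h₃ : {a, c, d} ∈ G.edges) : K4minus.IsHom G ![a, b, c, d] := by
  intro e he
  simp only [K4minus, Finset.mem_insert, Finset.mem_singleton] at he
  rcases he with rfl | rfl | rfl <;> simpa [Finset.image_insert]

lemma isHom_FStar {a b c d e f g : V} (h₁ : {a, b, c} ∈ G.edges) (h₂ : {a, b, d} ∈ G.edges)
    (h₃ : {c, d, e} ∈ G.edges) (h₄ : {a, e, f} ∈ G.edges) (h₅ : {b, e, g} ∈ G.edges) :
    FStar.IsHom G ![a, b, c, d, e, f, g] := by
  intro s hs
  simp only [FStar, Finset.mem_insert, Finset.mem_singleton] at hs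
  rcases hs with rfl | rfl | rfl | rfl | rfl <;> simpa [Finset.image_insert]

/-- Without homomorphic images of `K₄⁻` and `F⋆`, two edges of a set `S` in which all pairs are
covered never share a pair: a pair covering the two remaining vertices would produce `K₄⁻`, or
`F₅ = {123, 124, 345}` and, by covering the pairs `15` and `25`, `F⋆`. -/
lemma eq_of_mem_edges_of_covered (hK : ∀ f, ¬ K4minus.IsHom G f) (hF : ∀ f, ¬ FStar.IsHom G f)
    {S : Set V} (hcov : ∀ u ∈ S, ∀ v ∈ S, u ≠ v → ∃ w ∈ S, {u, v, w} ∈ G.edges) {a j k l : V}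
    (ha : a ∈ S) (hj : j ∈ S) (hk : k ∈ S) (hl : l ∈ S) (h₁ : {a, j, k} ∈ G.edges)
    (h₂ : {a, j, l} ∈ G.edges) : k = l := by
  by_contra hkl
  obtain ⟨w, hw, hklw⟩ := hcov k hk l hl hkl
  by_cases hwa : w = a
  · subst hwa
    have h₃ : {w, k, l} ∈ G.edges := by
      rw [show ({w, k, l} : Finset V) = {k, l, w} by ext; simp; tauto]; exact hklw
    exact hK _ (isHom_K4minus h₁ h₂ h₃)
  by_cases hwj : w = j
  · subst hwj
    have h₃ : {w, k, l} ∈ G.edges := by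
      rw [show ({w, k, l} : Finset V) = {k, l, w} by ext; simp; tauto]; exact hklw
    rw [Finset.insert_comm] at h₁ h₂
    exact hK _ (isHom_K4minus h₁ h₂ h₃)
  obtain ⟨p, -, hp⟩ := hcov a ha w hw (Ne.symm hwa)
  obtain ⟨q, -, hq⟩ := hcov j hj w hw (Ne.symm hwj)
  exact hF _ (isHom_FStar h₁ h₂ hklw hp hq)

end Adj

/-! ### The Lagrangian of `3`-graphs without homomorphic images of `K₄⁻` and `F⋆` -/

section Lagrangian

variable {V : Type*} [Fintype V] [DecidableEq V] {G : RGraph 3 V}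

/-- The symmetric trilinear form of a `3`-graph. On the diagonal it is six times the Lagrange
polynomial. -/
def triForm (G : RGraph 3 V) (x y z : V → ℝ) : ℝ := ∑ i, ∑ j, ∑ k, G.adj i j k * (x i * y j * z k)

lemma triForm_swap_left (x y z : V → ℝ) : G.triForm x y z = G.triForm y x z := by
  unfold triForm
  rw [Finset.sum_comm]
  refine Finset.sum_congr rfl fun i _ => Finset.sum_congr rfl fun j _ =>
    Finset.sum_congr rfl fun k _ => ?_
  rw [adj_swap_left]; ring

lemma triForm_swap_right (x y z : V → ℝ) : G.triForm x y z = G.triForm x z y := by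
  unfold triForm
  refine Finset.sum_congr rfl fun i _ => ?_
  rw [Finset.sum_comm]
  refine Finset.sum_congr rfl fun j _ => Finset.sum_congr rfl fun k _ => ?_
  rw [adj_swap_right]; ring

lemma triForm_add_smul (x d y z : V → ℝ) (t : ℝ) :
    G.triForm (x + t • d) y z = G.triForm x y z + t * G.triForm d y z := by
  unfold triForm
  simp only [Finset.mul_sum, ← Finset.sum_add_distrib]
  refine Finset.sum_congr rfl fun i _ => Finset.sum_congr rfl fun j _ =>
    Finset.sum_congr rfl fun k _ => ?_
  simp only [Pi.add_apply, Pi.smul_apply, smul_eq_mul]; ring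

lemma triForm_smul (c : ℝ) (x : V → ℝ) :
    G.triForm (c • x) (c • x) (c • x) = c ^ 3 * G.triForm x x x := by
  unfold triForm
  simp only [Finset.mul_sum]
  refine Finset.sum_congr rfl fun i _ => Finset.sum_congr rfl fun j _ =>
    Finset.sum_congr rfl fun k _ => ?_
  simp only [Pi.smul_apply, smul_eq_mul]; ring

lemma triForm_cube_add_smul (x d : V → ℝ) (t : ℝ) :
    G.triForm (x + t • d) (x + t • d) (x + t • d) =
      G.triForm x x x + 3 * t * G.triForm d x x + 3 * t ^ 2 * G.triForm d d x
        + t ^ 3 * G.triForm d d d := by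
  have h₁ : ∀ y z, G.triForm y (x + t • d) z = G.triForm y x z + t * G.triForm y d z := by
    intro y z
    rw [triForm_swap_left, triForm_add_smul, triForm_swap_left x, triForm_swap_left d]
  have h₂ : ∀ y z, G.triForm y z (x + t • d) = G.triForm y z x + t * G.triForm y z d := by
    intro y z
    rw [triForm_swap_right, h₁, triForm_swap_right y x, triForm_swap_right y d]
  simp only [triForm_add_smul, h₁, h₂]
  rw [triForm_swap_left x d x, triForm_swap_right x x d, triForm_swap_left x d x,
    triForm_swap_left x d d, triForm_swap_right d x d]
  ring

lemma triForm_single (a : V) (y z : V → ℝ) :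
    G.triForm (Pi.single a 1) y z = ∑ j, ∑ k, G.adj a j k * (y j * z k) := by
  unfold triForm
  rw [Finset.sum_eq_single a]
  · simp
  · intro b _ hb; simp [hb]
  · simp

lemma triForm_single_single (a b : V) (z : V → ℝ) :
    G.triForm (Pi.single a 1) (Pi.single b 1) z = ∑ k, G.adj a b k * z k := by
  rw [triForm_single, Finset.sum_eq_single b]
  · simp
  · intro c _ hc; simp [hc]
  · simp

lemma triForm_nonneg {x y z : V → ℝ} (hx : 0 ≤ x) (hy : 0 ≤ y) (hz : 0 ≤ z) :
    0 ≤ G.triForm x y z :=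
  Finset.sum_nonneg fun i _ => Finset.sum_nonneg fun j _ => Finset.sum_nonneg fun k _ =>
    mul_nonneg (adj_nonneg _ _ _) (mul_nonneg (mul_nonneg (hx i) (hy j)) (hz k))

lemma continuous_triForm_cube : Continuous fun x : V → ℝ => G.triForm x x x := by
  unfold triForm
  fun_prop

/-- A maximizer of the cubic form on the simplex that has the smallest possible support. -/
lemma exists_maximizer [Nonempty V] (G : RGraph 3 V) :
    ∃ x ∈ stdSimplex ℝ V, (∀ y ∈ stdSimplex ℝ V, G.triForm y y y ≤ G.triForm x x x) ∧
      ∀ y ∈ stdSimplex ℝ V, G.triForm y y y = G.triForm x x x →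
        (Finset.univ.filter fun i => x i ≠ 0).card ≤
          (Finset.univ.filter fun i => y i ≠ 0).card := by
  obtain ⟨x₀, hx₀, hmax⟩ := (isCompact_stdSimplex ℝ V).exists_isMaxOn
    ⟨Pi.single (Classical.arbitrary V) 1, single_mem_stdSimplex ℝ _⟩
    (continuous_triForm_cube (G := G)).continuousOn
  let S : Set (V → ℝ) := {x | x ∈ stdSimplex ℝ V ∧ G.triForm x x x = G.triForm x₀ x₀ x₀}
  let c : (V → ℝ) → ℕ := fun x => (Finset.univ.filter fun i => x i ≠ 0).card
  obtain ⟨x, hxS, hx⟩ := (measure c).wf.has_min S ⟨x₀, hx₀, rfl⟩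
  refine ⟨x, hxS.1, fun y hy => ?_, fun y hy hyx => ?_⟩
  · rw [hxS.2]; exact hmax hy
  · exact not_lt.mp (hx y ⟨hy, hyx.trans hxS.2⟩)

/-- In a maximizer of minimal support every two vertices of the support lie in a common edge
inside the support: otherwise the cubic form is linear along the exchange of weight between the two
vertices, and one of them can be emptied. -/
lemma exists_edge_of_minimal_support {x : V → ℝ} (hx : x ∈ stdSimplex ℝ V)
    (hmax : ∀ y ∈ stdSimplex ℝ V, G.triForm y y y ≤ G.triForm x x x)
    (hmin : ∀ y ∈ stdSimplex ℝ V, G.triForm y y y = G.triForm x x x →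
      (Finset.univ.filter fun i => x i ≠ 0).card ≤ (Finset.univ.filter fun i => y i ≠ 0).card)
    {u v : V} (huv : u ≠ v) (hu : x u ≠ 0) (hv : x v ≠ 0) :
    ∃ w, x w ≠ 0 ∧ {u, v, w} ∈ G.edges := by
  by_contra! hcon
  have hzero : ∀ k, G.adj u v k * x k = 0 := by
    intro k
    by_cases hk : x k = 0
    · simp [hk]
    · simp [adj_eq_zero (hcon k hk)]
  wlog hD : G.triForm (Pi.single v 1) x x ≤ G.triForm (Pi.single u 1) x x generalizing u v
  · refine this huv.symm hv hu ?_ ?_ (le_of_not_ge hD)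
    · intro w hw; rw [Finset.insert_comm]; exact hcon w hw
    · intro k; rw [adj_swap_left]; exact hzero k
  set d : V → ℝ := Pi.single u 1 + (-1 : ℝ) • Pi.single v 1 with hd
  have hlin : ∀ y z, G.triForm d y z =
      G.triForm (Pi.single u 1) y z - G.triForm (Pi.single v 1) y z := by
    intro y z; rw [hd, triForm_add_smul]; ring
  have hlin' : ∀ y z, G.triForm y d z =
      G.triForm y (Pi.single u 1) z - G.triForm y (Pi.single v 1) z := by
    intro y z
    rw [triForm_swap_left, hlin, triForm_swap_left y, triForm_swap_left y]
  have hdd : ∀ z, G.triForm d d z = -2 * ∑ k, G.adj u v k * z k := by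
    intro z
    rw [hlin, hlin', hlin', triForm_single_single, triForm_single_single, triForm_single_single,
      triForm_single_single]
    simp only [adj_self_left, adj_swap_left v u]
    simp; ring
  have hddx : G.triForm d d x = 0 := by
    rw [hdd, Finset.sum_eq_zero fun k _ => hzero k]; ring
  have hddd : G.triForm d d d = 0 := by
    rw [hdd, Finset.sum_eq_zero, mul_zero]
    intro k _
    by_cases hku : k = u
    · subst hku; rw [adj_swap_right, adj_self_left]; simp
    · by_cases hkv : k = v
      · subst hkv; rw [adj_swap_left, adj_swap_right, adj_self_left]; simp
      · simp [hd, hku, hkv]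
  set y : V → ℝ := x + x v • d with hy
  have hyv : y v = 0 := by simp [hy, hd, huv.symm]
  have hyi : ∀ i, i ≠ u → i ≠ v → y i = x i := by
    intro i hiu hiv; simp [hy, hd, hiu, hiv]
  have hyS : y ∈ stdSimplex ℝ V := by
    refine ⟨fun i => ?_, ?_⟩
    · by_cases hiv : i = v
      · rw [hiv, hyv]
      · by_cases hiu : i = u
        · subst hiu; simp [hy, hd, huv]; linarith [hx.1 i, hx.1 v]
        · rw [hyi i hiu hiv]; exact hx.1 i
    · have h1 := hx.2
      simp [hy, hd, Finset.sum_add_distrib, ← Finset.mul_sum, h1]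
  have hval : G.triForm y y y = G.triForm x x x := by
    refine le_antisymm (hmax y hyS) ?_
    rw [hy, triForm_cube_add_smul, hddx, hddd, hlin]
    nlinarith [mul_nonneg (hx.1 v) (sub_nonneg.mpr hD)]
  refine absurd (hmin y hyS hval) (not_le.mpr (Finset.card_lt_card ?_))
  refine (Finset.ssubset_iff_of_subset ?_).mpr ⟨v, by simp [hv], by simp [hyv]⟩
  intro i hi
  simp only [Finset.mem_filter, Finset.mem_univ, true_and] at hi ⊢
  intro h0
  by_cases hiv : i = v
  · exact hv (hiv ▸ h0)
  · by_cases hiu : i = u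
    · exact hu (hiu ▸ h0)
    · exact hi ((hyi i hiu hiv).trans h0)

/-- The first-order condition at a maximizer: no partial derivative at a vertex of the support is
below its average. -/
lemma triForm_le_triForm_single {x : V → ℝ} (hx : x ∈ stdSimplex ℝ V)
    (hmax : ∀ y ∈ stdSimplex ℝ V, G.triForm y y y ≤ G.triForm x x x) {a : V} (ha : 0 < x a) :
    G.triForm x x x ≤ G.triForm (Pi.single a 1) x x := by
  set P := G.triForm x x x with hP
  set D := G.triForm (Pi.single a 1) x x with hD
  have hP0 : 0 ≤ P := triForm_nonneg hx.1 hx.1 hx.1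
  have ha1 : x a ≤ 1 := by
    rw [← hx.2]; exact Finset.single_le_sum (fun i _ => hx.1 i) (Finset.mem_univ a)
  have key : ∀ s, 0 < s → s < x a → P * (1 - s) ≤ D := by
    intro s hs hsa
    have hs1 : 0 < 1 - s := by linarith
    set y : V → ℝ := x + (-s) • Pi.single a 1 with hy
    have hdd : ∀ z, G.triForm (Pi.single a 1) (Pi.single a 1) z = 0 := by
      intro z; rw [triForm_single_single]; simp [adj_self_left]
    have hyval : G.triForm y y y = P - 3 * s * D := by
      rw [hy, triForm_cube_add_smul, hdd, hdd]; ring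
    have hyS : (1 - s)⁻¹ • y ∈ stdSimplex ℝ V := by
      refine ⟨fun i => ?_, ?_⟩
      · refine mul_nonneg (by positivity) ?_
        by_cases hia : i = a
        · subst hia; simp [hy]; linarith
        · simp [hy, hia, hx.1 i]
      · have h1 := hx.2
        simp only [Pi.smul_apply, smul_eq_mul, ← Finset.mul_sum]
        have : ∑ i, y i = 1 - s := by
          simp [hy, Finset.sum_add_distrib, h1, Finset.sum_neg_distrib, ← Finset.mul_sum]; ring
        rw [this]; field_simp
    have h := hmax _ hyS
    rw [triForm_smul, hyval] at h
    have h3 : P - 3 * s * D ≤ P * (1 - s) ^ 3 := by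
      rw [inv_pow, inv_mul_le_iff₀ (by positivity)] at h
      linarith
    have h4 : s * (P * (1 - s)) ≤ s * D := by nlinarith [mul_nonneg hP0 (by positivity : 0 ≤ s ^ 3)]
    exact le_of_mul_le_mul_left h4 hs
  by_contra! hlt
  have hD0 : 0 ≤ D := by
    refine triForm_nonneg (fun i => ?_) hx.1 hx.1
    by_cases h : i = a
    · subst h; simp
    · simp [h]
  have hPpos : 0 < P := lt_of_le_of_lt hD0 hlt
  have hs : 0 < min (x a / 2) ((P - D) / (2 * P)) :=
    lt_min (by linarith) (div_pos (by linarith) (by linarith))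
  have h := key _ hs (lt_of_le_of_lt (min_le_left _ _) (by linarith))
  have h2 : P * min (x a / 2) ((P - D) / (2 * P)) ≤ (P - D) / 2 := by
    calc P * min (x a / 2) ((P - D) / (2 * P)) ≤ P * ((P - D) / (2 * P)) :=
          mul_le_mul_of_nonneg_left (min_le_right _ _) hP0
      _ = (P - D) / 2 := by field_simp
  linarith

/-- The Lagrangian bound for a point `x` of the simplex whose support carries a linear `3`-graph
(any two edges share at most one vertex), at which the derivative at the heaviest vertex is at
least the value. -/
lemma triForm_le_of_linear {x : V → ℝ} (hx : x ∈ stdSimplex ℝ V) {a : V} (ha : ∀ i, x i ≤ x a)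
    (hD : G.triForm x x x ≤ G.triForm (Pi.single a 1) x x)
    (hlin : ∀ j k l, x j ≠ 0 → x k ≠ 0 → x l ≠ 0 → {a, j, k} ∈ G.edges → {a, j, l} ∈ G.edges →
      k = l) :
    G.triForm x x x ≤ 2 / 9 := by
  -- `g j k` is the adjacency of the link of `a`, a matching of the support.
  set g : V → V → ℝ := fun j k => if x j ≠ 0 ∧ x k ≠ 0 then G.adj a j k else 0 with hg
  have hg0 : ∀ j k, 0 ≤ g j k := by
    intro j k; simp only [hg]; split_ifs; exacts [adj_nonneg _ _ _, le_rfl]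
  have hgsymm : ∀ j k, g j k = g k j := by
    intro j k; simp only [hg, adj_swap_right a j k, and_comm]
  have hDg : G.triForm (Pi.single a 1) x x = ∑ j, ∑ k, g j k * (x j * x k) := by
    rw [triForm_single]
    refine Finset.sum_congr rfl fun j _ => Finset.sum_congr rfl fun k _ => ?_
    simp only [hg]
    split_ifs with h
    · rfl
    · by_cases hj : x j = 0
      · simp [hj]
      · have : x k = 0 := by tauto
        simp [this]
  have hrow : ∀ j, ∑ k, g j k ≤ 1 := by
    intro j
    by_cases hex : ∃ k, g j k ≠ 0
    · obtain ⟨k, hk⟩ := hex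
      have hk' : (x j ≠ 0 ∧ x k ≠ 0) ∧ {a, j, k} ∈ G.edges := by
        simp only [hg, adj] at hk
        by_contra hne
        apply hk
        split_ifs <;> tauto
      rw [Finset.sum_eq_single k]
      · simp only [hg, adj]; split_ifs <;> norm_num
      · intro l _ hlk
        by_contra hl
        have hl' : (x j ≠ 0 ∧ x l ≠ 0) ∧ {a, j, l} ∈ G.edges := by
          simp only [hg, adj] at hl
          by_contra hne
          apply hl
          split_ifs <;> tauto
        exact hlk (hlin j l k hk'.1.1 hl'.1.2 hk'.1.2 hl'.2 hk'.2)
      · simp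
    · push Not at hex
      simp [hex]
  have hga : ∀ k, g a k = 0 := by
    intro k; simp [hg, adj_self_left]
  set M := x a with hM
  have hM0 : 0 ≤ M := hx.1 a
  have hM1 : M ≤ 1 := by
    rw [← hx.2]; exact Finset.single_le_sum (fun i _ => hx.1 i) (Finset.mem_univ a)
  have hsum : ∑ j, ∑ k, g j k * x j ≤ 1 - M := by
    have h : ∀ j, ∑ k, g j k * x j ≤ x j - Pi.single (M := fun _ => ℝ) a M j := by
      intro j
      rw [← Finset.sum_mul]
      by_cases hja : j = a
      · subst hja; simp [hga, hM]
      · simp only [ne_eq, hja, not_false_eq_true, Pi.single_eq_of_ne, sub_zero]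
        exact mul_le_of_le_one_left (hx.1 j) (hrow j)
    calc ∑ j, ∑ k, g j k * x j ≤ ∑ j, (x j - Pi.single (M := fun _ => ℝ) a M j) :=
          Finset.sum_le_sum fun j _ => h j
      _ = 1 - M := by rw [Finset.sum_sub_distrib, hx.2]; simp
  have hsum' : ∑ j, ∑ k, g j k * x k ≤ 1 - M := by
    rw [Finset.sum_comm]
    refine le_of_eq_of_le ?_ hsum
    exact Finset.sum_congr rfl fun k _ => Finset.sum_congr rfl fun j _ => by rw [hgsymm]
  have hbound₁ : ∑ j, ∑ k, g j k * (x j * x k) ≤ M * (1 - M) := by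
    calc ∑ j, ∑ k, g j k * (x j * x k) ≤ ∑ j, ∑ k, M * (g j k * x j) := by
          refine Finset.sum_le_sum fun j _ => Finset.sum_le_sum fun k _ => ?_
          nlinarith [mul_nonneg (mul_nonneg (hg0 j k) (hx.1 j)) (sub_nonneg.mpr (ha k))]
      _ ≤ M * (1 - M) := by
          simp only [← Finset.mul_sum]
          exact mul_le_mul_of_nonneg_left hsum hM0
  have hbound₂ : 4 * ∑ j, ∑ k, g j k * (x j * x k) ≤ (1 - M) * (2 * (1 - M)) := by
    calc 4 * ∑ j, ∑ k, g j k * (x j * x k)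
        ≤ ∑ j, ∑ k, (1 - M) * (g j k * x j + g j k * x k) := by
          rw [Finset.mul_sum]
          refine Finset.sum_le_sum fun j _ => ?_
          rw [Finset.mul_sum]
          refine Finset.sum_le_sum fun k _ => ?_
          by_cases hgz : g j k = 0
          · simp [hgz]
          · have hedge : {a, j, k} ∈ G.edges := by
              by_contra hne
              exact hgz (by simp [hg, adj_eq_zero hne])
            obtain ⟨haj, hak, hjk⟩ := ne_of_mem_edges hedge
            have h3 : x j + x k ≤ 1 - M := by
              have h : ∑ i ∈ ({a, j, k} : Finset V), x i ≤ ∑ i, x i :=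
                Finset.sum_le_sum_of_subset_of_nonneg (Finset.subset_univ _) fun i _ _ => hx.1 i
              rw [Finset.sum_insert (by simp [haj, hak]), Finset.sum_pair hjk, hx.2] at h
              linarith
            have h4 : 4 * (x j * x k) ≤ (1 - M) * (x j + x k) := by
              nlinarith [sq_nonneg (x j - x k),
                mul_nonneg (add_nonneg (hx.1 j) (hx.1 k)) (sub_nonneg.mpr h3)]
            nlinarith [mul_le_mul_of_nonneg_left h4 (hg0 j k)]
      _ = (1 - M) * (∑ j, ∑ k, g j k * x j + ∑ j, ∑ k, g j k * x k) := by
          simp only [← Finset.mul_sum, Finset.sum_add_distrib]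
      _ ≤ (1 - M) * (2 * (1 - M)) :=
          mul_le_mul_of_nonneg_left (by linarith) (by linarith)
  rw [hDg] at hD
  rcases le_total M (1 / 3) with h | h
  · nlinarith
  · nlinarith

/-- A `3`-graph that receives no homomorphism from `K₄⁻` or `F⋆` has Lagrangian density at most
`2 / 9`. -/
theorem triForm_le_two_ninths (hK : ∀ f, ¬ K4minus.IsHom G f) (hF : ∀ f, ¬ FStar.IsHom G f)
    {y : V → ℝ} (hy : y ∈ stdSimplex ℝ V) : G.triForm y y y ≤ 2 / 9 := by
  have : Nonempty V := by
    by_contra h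
    rw [not_nonempty_iff] at h
    simpa using hy.2
  obtain ⟨x, hx, hmax, hmin⟩ := exists_maximizer G
  refine (hmax y hy).trans ?_
  obtain ⟨a, -, ha⟩ := Finset.exists_max_image Finset.univ x Finset.univ_nonempty
  have ha' : ∀ i, x i ≤ x a := fun i => ha i (Finset.mem_univ i)
  have hapos : 0 < x a := by
    by_contra! h
    have : ∑ i, x i ≤ 0 := Finset.sum_nonpos fun i _ => (ha' i).trans h
    rw [hx.2] at this
    linarith
  refine triForm_le_of_linear hx ha' (triForm_le_triForm_single hx hmax hapos) ?_
  intro j k l hj hk hl h₁ h₂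
  refine eq_of_mem_edges_of_covered hK hF (S := {i | x i ≠ 0}) ?_ hapos.ne' hj hk hl h₁ h₂
  intro u hu v hv huv
  exact exists_edge_of_minimal_support hx hmax hmin huv hu hv

/-- The number of ordered triples that span an edge, in a `3`-graph that receives no homomorphism
from `K₄⁻` or `F⋆`. -/
theorem sum_adj_le (hK : ∀ f, ¬ K4minus.IsHom G f) (hF : ∀ f, ¬ FStar.IsHom G f) :
    ∑ i, ∑ j, ∑ k, G.adj i j k ≤ 2 / 9 * (Fintype.card V : ℝ) ^ 3 := by
  rcases isEmpty_or_nonempty V with h | h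
  · simp
  have hn : (0 : ℝ) < Fintype.card V := by exact_mod_cast Fintype.card_pos
  have hy : (fun _ : V => (Fintype.card V : ℝ)⁻¹) ∈ stdSimplex ℝ V := by
    refine ⟨fun i => by positivity, ?_⟩
    simp [hn.ne']
  have h := triForm_le_two_ninths hK hF hy
  unfold triForm at h
  simp only [← Finset.sum_mul] at h
  rw [← mul_inv, ← mul_inv, ← div_eq_mul_inv, div_le_iff₀ (by positivity)] at h
  linarith [show (Fintype.card V : ℝ) ^ 3 =
    Fintype.card V * Fintype.card V * Fintype.card V by ring]

end Lagrangian
end RGraph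

/-! ### Boxes in dense sets of tuples -/

namespace RGraph

section Boxes

variable {V : Type*} [Fintype V] [DecidableEq V]

/-- The families of `d` rows of `k` vertices all of whose transversals lie in `A`. -/
def boxes {d : ℕ} (k : ℕ) (A : Finset (Fin d → V)) : Finset (Fin d → Fin k → V) :=
  Finset.univ.filter fun Φ => ∀ s : Fin d → Fin k, (fun i => Φ i (s i)) ∈ A

lemma mem_boxes {d k : ℕ} {A : Finset (Fin d → V)} {Φ : Fin d → Fin k → V} :
    Φ ∈ boxes k A ↔ ∀ s : Fin d → Fin k, (fun i => Φ i (s i)) ∈ A := by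
  simp [boxes]

lemma pow_average_le {ι : Type*} [Fintype ι] [Nonempty ι] (f : ι → ℝ) (hf : ∀ i, 0 ≤ f i) {K : ℕ}
    (hK : K ≠ 0) :
    ((∑ i, f i) / Fintype.card ι) ^ K ≤ (∑ i, f i ^ K) / Fintype.card ι := by
  obtain ⟨K, rfl⟩ := Nat.exists_eq_succ_of_ne_zero hK
  have h := pow_sum_div_card_le_sum_pow (s := Finset.univ) (f := f) (fun i _ => hf i) K
  have hc : (0 : ℝ) < Fintype.card ι := by exact_mod_cast Fintype.card_pos
  rw [Finset.card_univ, div_le_iff₀ (by positivity)] at h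
  rw [div_pow, div_le_div_iff₀ (by positivity) hc, Nat.succ_eq_add_one, pow_succ (_ : ℝ) K]
  rw [pow_succ (Fintype.card ι : ℝ) K]
  rw [pow_succ] at h
  nlinarith

/-- The tuples that complete each of the vertices `x l` to an element of `A`. -/
def commonTails {d k : ℕ} (A : Finset (Fin (d + 1) → V)) (x : Fin k → V) : Finset (Fin d → V) :=
  Finset.univ.filter fun y => ∀ l, (Fin.cons (x l) y : Fin (d + 1) → V) ∈ A

lemma sum_card_boxes_commonTails_le {d k : ℕ} (A : Finset (Fin (d + 1) → V)) :
    ∑ x : Fin k → V, (boxes k (commonTails A x)).card ≤ (boxes k A).card := by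
  rw [← Finset.card_sigma]
  refine Finset.card_le_card_of_injOn
    (fun p => (Fin.cons p.1 p.2 : Fin (d + 1) → Fin k → V)) ?_ ?_
  · rintro ⟨x, Ψ⟩ hp
    have hp' : Ψ ∈ boxes k (commonTails A x) := by simpa using hp
    rw [mem_boxes] at hp'
    simp only [Finset.mem_coe, mem_boxes]
    intro s
    have h := hp' fun i => s i.succ
    simp only [commonTails, Finset.mem_filter, Finset.mem_univ, true_and] at h
    convert h (s 0) using 1
    funext i
    refine Fin.cases ?_ (fun i => ?_) i <;> simp
  · rintro ⟨x, Ψ⟩ - ⟨x', Ψ'⟩ - h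
    obtain ⟨rfl, rfl⟩ := Fin.cons_injective2 h
    rfl

lemma sum_card_commonTails {d k : ℕ} (A : Finset (Fin (d + 1) → V)) :
    ∑ x : Fin k → V, (commonTails A x).card =
      ∑ y : Fin d → V,
        (Finset.univ.filter fun v => (Fin.cons v y : Fin (d + 1) → V) ∈ A).card ^ k := by
  have h : ∀ y : Fin d → V,
      (Finset.univ.filter fun v => (Fin.cons v y : Fin (d + 1) → V) ∈ A).card ^ k =
        (Finset.univ.filter fun x : Fin k → V =>
          ∀ l, (Fin.cons (x l) y : Fin (d + 1) → V) ∈ A).card := by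
    intro y
    have e := Fintype.card_piFinset_const
      (Finset.univ.filter fun v => (Fin.cons v y : Fin (d + 1) → V) ∈ A) k
    rw [← e]
    congr 1
    ext x
    simp [Fintype.mem_piFinset]
  simp only [h, commonTails]
  exact Finset.sum_card_bipartiteAbove_eq_sum_card_bipartiteBelow _

lemma card_eq_sum_heads {d : ℕ} (A : Finset (Fin (d + 1) → V)) :
    A.card =
      ∑ y : Fin d → V, (Finset.univ.filter fun v => (Fin.cons v y : Fin (d + 1) → V) ∈ A).card := by
  rw [← Finset.card_sigma]
  refine Finset.card_bij' (fun a _ => ⟨Fin.tail a, a 0⟩)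
    (fun p _ => (Fin.cons p.2 p.1 : Fin (d + 1) → V)) ?_ ?_ ?_ ?_
  · intro a ha; simpa using ha
  · rintro ⟨y, v⟩ hp; simpa using hp
  · intro a _; simp
  · rintro ⟨y, v⟩ _; simp

/-- Dense sets of `d`-tuples contain a positive proportion of all `d × k` boxes, by convexity. -/
theorem density_pow_le_density_boxes [Nonempty V] (k : ℕ) (hk : k ≠ 0) :
    ∀ (d : ℕ) (A : Finset (Fin d → V)),
      ((A.card : ℝ) / (Fintype.card V : ℝ) ^ d) ^ k ^ d ≤
        ((boxes k A).card : ℝ) / (Fintype.card V : ℝ) ^ (k * d) := by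
  have hn : (0 : ℝ) < Fintype.card V := by exact_mod_cast Fintype.card_pos
  intro d
  induction d with
  | zero =>
    intro A
    rcases A.eq_empty_or_nonempty with rfl | ⟨a, ha⟩
    · simp
    · have h₁ : A.card ≤ 1 := by
        simpa using Finset.card_le_univ A
      have h₂ : 0 < (boxes k A).card := by
        refine Finset.card_pos.mpr ⟨fun i => i.elim0, mem_boxes.mpr fun s => ?_⟩
        rwa [Subsingleton.elim (fun i => _) a]
      simp only [pow_zero, div_one, pow_one, mul_zero]
      exact_mod_cast h₁.trans h₂
  | succ d ih =>
    intro A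
    set n : ℝ := (Fintype.card V : ℝ) with hn_def
    set deg : (Fin d → V) → ℕ := fun y =>
      (Finset.univ.filter fun v => (Fin.cons v y : Fin (d + 1) → V) ∈ A).card with hdeg
    have hcard : ∀ m : ℕ, (Fintype.card (Fin m → V) : ℝ) = n ^ m := by intro m; simp [hn_def]
    have h₁ : ((A.card : ℝ) / n ^ (d + 1)) ^ k ≤
        (∑ x : Fin k → V, ((commonTails A x).card : ℝ) / n ^ d) / n ^ k := by
      have h := pow_average_le (fun y : Fin d → V => (deg y : ℝ) / n) (fun y => by positivity) hk
      rw [hcard, ← Finset.sum_div, ← Nat.cast_sum, hdeg, ← card_eq_sum_heads] at h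
      simp only [div_pow (Nat.cast _ : ℝ) n k] at h
      rw [← Finset.sum_div] at h
      have e : (∑ y : Fin d → V, ((Finset.univ.filter fun v =>
          (Fin.cons v y : Fin (d + 1) → V) ∈ A).card : ℝ) ^ k) =
          ∑ x : Fin k → V, ((commonTails A x).card : ℝ) := by
        exact_mod_cast (sum_card_commonTails A).symm
      rw [e] at h
      rw [← Finset.sum_div]
      calc ((A.card : ℝ) / n ^ (d + 1)) ^ k = ((A.card : ℝ) / n / n ^ d) ^ k := by
            rw [pow_succ, div_div, mul_comm n]
        _ ≤ _ := h
        _ = _ := by rw [div_div, div_div, mul_comm]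
    have h₂ := pow_average_le (fun x : Fin k → V => ((commonTails A x).card : ℝ) / n ^ d)
      (fun x => by positivity) (pow_ne_zero d hk)
    rw [hcard] at h₂
    calc ((A.card : ℝ) / n ^ (d + 1)) ^ k ^ (d + 1)
        = (((A.card : ℝ) / n ^ (d + 1)) ^ k) ^ k ^ d := by rw [← pow_mul, pow_succ' k]
      _ ≤ ((∑ x : Fin k → V, ((commonTails A x).card : ℝ) / n ^ d) / n ^ k) ^ k ^ d :=
          pow_le_pow_left₀ (by positivity) h₁ _
      _ ≤ _ := h₂
      _ ≤ (∑ x : Fin k → V, ((boxes k (commonTails A x)).card : ℝ) / n ^ (k * d)) / n ^ k := by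
          gcongr with x
          exact ih (commonTails A x)
      _ ≤ ((boxes k A).card : ℝ) / n ^ (k * (d + 1)) := by
          rw [← Finset.sum_div, div_div, ← pow_add, mul_add, mul_one]
          gcongr
          exact_mod_cast sum_card_boxes_commonTails_le A

lemma card_filter_not_injective_mul_le (ι : Type*) [Fintype ι] [DecidableEq ι] :
    (Finset.univ.filter fun φ : ι → V => ¬ Function.Injective φ).card * Fintype.card V ≤
      Fintype.card ι ^ 2 * Fintype.card V ^ Fintype.card ι := by
  have hpair : ∀ p : ι × ι, (Finset.univ.filter fun φ : ι → V => p.1 ≠ p.2 ∧ φ p.1 = φ p.2).card *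
      Fintype.card V ≤ Fintype.card V ^ Fintype.card ι := by
    rintro ⟨i, j⟩
    have h : (Finset.univ.filter fun φ : ι → V => i ≠ j ∧ φ i = φ j).card * Fintype.card V =
        ((Finset.univ.filter fun φ : ι → V => i ≠ j ∧ φ i = φ j) ×ˢ
          (Finset.univ : Finset V)).card := by
      rw [Finset.card_product, Finset.card_univ]
    rw [h, ← Fintype.card_fun, ← Finset.card_univ]
    -- The value at `j` is redundant, so it can be replaced by an arbitrary vertex.
    refine Finset.card_le_card_of_injOn (fun q => Function.update q.1 j q.2) (by simp) ?_
    rintro ⟨φ, v⟩ hφ ⟨φ', v'⟩ hφ' heq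
    simp only [Finset.coe_product, Set.mem_prod, Finset.mem_coe, Finset.mem_filter,
      Finset.mem_univ, true_and, and_true] at hφ hφ' heq
    have hl : ∀ l, l ≠ j → φ l = φ' l := fun l hl => by
      have := congrFun heq l
      simpa [hl] using this
    have hv : v = v' := by simpa using congrFun heq j
    have hφφ : φ = φ' := by
      funext l
      by_cases hlj : l = j
      · rw [hlj, ← hφ.2, ← hφ'.2, hl i hφ.1]
      · exact hl l hlj
    rw [hv, hφφ]
  calc (Finset.univ.filter fun φ : ι → V => ¬ Function.Injective φ).card * Fintype.card V
      ≤ (∑ p : ι × ι, (Finset.univ.filter fun φ : ι → V =>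
          p.1 ≠ p.2 ∧ φ p.1 = φ p.2).card) * Fintype.card V := by
        gcongr
        refine (Finset.card_le_card ?_).trans Finset.card_biUnion_le
        intro φ hφ
        have hφ' := (Finset.mem_filter.mp hφ).2
        unfold Function.Injective at hφ'
        push Not at hφ'
        obtain ⟨i, j, h, hij⟩ := hφ'
        simp only [Finset.mem_biUnion, Finset.mem_univ, true_and, Finset.mem_filter]
        exact ⟨(i, j), hij, h⟩
    _ ≤ ∑ p : ι × ι, Fintype.card V ^ Fintype.card ι := by
        rw [Finset.sum_mul]
        exact Finset.sum_le_sum fun p _ => hpair p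
    _ = _ := by simp [sq]

end Boxes

/-- In a large vertex set, a set of `d`-tuples of positive density contains a box with pairwise
distinct entries. -/
theorem exists_injective_box (d k : ℕ) (hk : k ≠ 0) {c : ℝ} (hc : 0 < c) :
    ∃ n₀ : ℕ, ∀ n : ℕ, n₀ ≤ n → ∀ A : Finset (Fin d → Fin n), c * (n : ℝ) ^ d ≤ A.card →
      ∃ Φ : Fin d → Fin k → Fin n,
        Function.Injective (fun p : Fin d × Fin k => Φ p.1 p.2) ∧
          ∀ s : Fin d → Fin k, (fun i => Φ i (s i)) ∈ A := by
  obtain ⟨n₀, hn₀⟩ := exists_nat_gt (((d * k : ℕ) : ℝ) ^ 2 / c ^ k ^ d)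
  refine ⟨n₀ + 1, fun n hn A hA => ?_⟩
  have hnpos : (0 : ℝ) < n := by exact_mod_cast (show 0 < n by omega)
  have : Nonempty (Fin n) := ⟨⟨0, by omega⟩⟩
  by_contra! hcon
  have hboxes := density_pow_le_density_boxes k hk d A
  rw [Fintype.card_fin, le_div_iff₀ (by positivity)] at hboxes
  have hlow : c ^ k ^ d * (n : ℝ) ^ (k * d) ≤ (boxes k A).card := by
    refine le_trans ?_ hboxes
    gcongr
    rwa [le_div_iff₀ (by positivity)]
  have hle : (boxes k A).card ≤
      (Finset.univ.filter fun φ : Fin d × Fin k → Fin n => ¬ Function.Injective φ).card := by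
    refine Finset.card_le_card_of_injOn (fun Φ p => Φ p.1 p.2) ?_ ?_
    · intro Φ hΦ
      simp only [Finset.coe_filter, Finset.mem_univ, true_and, Set.mem_ofPred_eq]
      intro hinj
      obtain ⟨s, hs⟩ := hcon Φ hinj
      exact hs (mem_boxes.mp hΦ s)
    · intro Φ _ Φ' _ h
      funext i j
      exact congrFun h (i, j)
  have hup := card_filter_not_injective_mul_le (V := Fin n) (Fin d × Fin k)
  simp only [Fintype.card_prod, Fintype.card_fin] at hup
  have h : c ^ k ^ d * (n : ℝ) ^ (k * d) * n ≤ ((d * k : ℕ) : ℝ) ^ 2 * (n : ℝ) ^ (k * d) := by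
    calc c ^ k ^ d * (n : ℝ) ^ (k * d) * n ≤ ((boxes k A).card : ℝ) * n := by gcongr
      _ ≤ _ := by
        rw [mul_comm k d]
        exact_mod_cast (Nat.mul_le_mul_right n hle).trans hup
  rw [div_lt_iff₀ (by positivity)] at hn₀
  have hn' : (n₀ : ℝ) ≤ n := by exact_mod_cast (by omega : n₀ ≤ n)
  have h2 : c ^ k ^ d * (n : ℝ) ≤ ((d * k : ℕ) : ℝ) ^ 2 := by
    refine le_of_mul_le_mul_right ?_ (by positivity : (0 : ℝ) < (n : ℝ) ^ (k * d))
    linarith [h]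
  nlinarith [pow_pos hc (k ^ d)]

end RGraph

/-! ### Supersaturation and the upper bound on the Turán density -/

namespace RGraph

/-- The pullback of an `r`-graph along a map `φ`: the `r`-sets whose image is an edge. -/
def comap {r : ℕ} {U V : Type*} [Fintype U] [DecidableEq V] (φ : U → V) (H : RGraph r V) :
    RGraph r U where
  edges := (Finset.powersetCard r Finset.univ).filter fun e => e.image φ ∈ H.edges
  card_eq := fun _ he => (Finset.mem_powersetCard.mp (Finset.mem_filter.mp he).1).2

section Comap

variable {r : ℕ} {U V W : Type*} [Fintype U] [DecidableEq V]

lemma mem_comap_edges {φ : U → V} {H : RGraph r V} {e : Finset U} :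
    e ∈ (comap φ H).edges ↔ e.card = r ∧ e.image φ ∈ H.edges := by
  simp [comap, Finset.mem_powersetCard]

lemma IsHom.comp_comap [DecidableEq U] {F : RGraph r W} {H : RGraph r V} {φ : U → V} {ψ : W → U}
    (h : F.IsHom (comap φ H) ψ) : F.IsHom H (φ ∘ ψ) := by
  intro e he
  rw [← Finset.image_image]
  exact (mem_comap_edges.mp (h e he)).2

lemma adj_comap [DecidableEq U] {φ : U → V} {H : RGraph 3 V} (i j k : U) :
    (comap φ H).adj i j k = H.adj (φ i) (φ j) (φ k) := by
  have h : {i, j, k} ∈ (comap φ H).edges ↔ {φ i, φ j, φ k} ∈ H.edges := by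
    rw [mem_comap_edges, Finset.image_insert, Finset.image_insert, Finset.image_singleton]
    refine ⟨fun h => h.2, fun h => ⟨?_, h⟩⟩
    obtain ⟨h₁, h₂, h₃⟩ := ne_of_mem_edges h
    exact Finset.card_triple_eq_three_iff.mpr
      ⟨fun h => h₁ (h ▸ rfl), fun h => h₂ (h ▸ rfl), fun h => h₃ (h ▸ rfl)⟩
  simp only [adj, h]

end Comap

lemma prod_isHom_fst {r : ℕ} {V W : Type*} [Fintype V] [Fintype W] [DecidableEq V] [DecidableEq W]
    (G : RGraph r V) (H : RGraph r W) : (G.prod H).IsHom G Prod.fst :=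
  fun _ he => (Finset.mem_filter.mp he).2.1

lemma prod_isHom_snd {r : ℕ} {V W : Type*} [Fintype V] [Fintype W] [DecidableEq V] [DecidableEq W]
    (G : RGraph r V) (H : RGraph r W) : (G.prod H).IsHom H Prod.snd :=
  fun _ he => (Finset.mem_filter.mp he).2.2

/-- If a positive proportion of the maps `φ : Fin d → Fin n` turn a fixed map `ψ` into a
homomorphism `φ ∘ ψ` from `Q` to `H`, then `H` contains every `F` that is homomorphic to `Q`:
the box of the tuples `φ` spans a blow-up of `Q` in `H`. -/
theorem contains_of_many_homs {r : ℕ} {X Y : Type*} [Fintype X] [DecidableEq Y] [Nonempty X]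
    {F : RGraph r X} {Q : RGraph r Y} {π : X → Y} (hπ : F.IsHom Q π) (d : ℕ) {c : ℝ} (hc : 0 < c) :
    ∃ n₀ : ℕ, ∀ n : ℕ, n₀ ≤ n → ∀ (H : RGraph r (Fin n)) (ψ : Y → Fin d)
      (A : Finset (Fin d → Fin n)), (∀ φ ∈ A, Q.IsHom H (φ ∘ ψ)) →
      c * (n : ℝ) ^ d ≤ A.card → H.Contains F := by
  obtain ⟨n₀, h⟩ := exists_injective_box d (Fintype.card X) Fintype.card_ne_zero hc
  refine ⟨n₀, fun n hn H ψ A hA hcard => ?_⟩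
  obtain ⟨Φ, hinj, hΦ⟩ := h n hn A hcard
  let idx := Fintype.equivFin X
  refine ⟨fun x => Φ (ψ (π x)) (idx x), fun x x' hxx' => ?_, fun e he => ?_⟩
  · have := @hinj (ψ (π x), idx x) (ψ (π x'), idx x') hxx'
    exact idx.injective (Prod.ext_iff.mp this).2
  · have hinj' : Set.InjOn (ψ ∘ π) e := by
      have h₀ := (hA _ (hΦ fun _ => idx (Classical.arbitrary X))) _ (hπ e he)
      rw [Finset.image_image] at h₀
      have h₁ : Set.InjOn _ (e : Set X) :=
        Finset.card_image_iff.mp ((H.card_eq _ h₀).trans (F.card_eq e he).symm)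
      exact Set.InjOn.of_comp (g := fun i => Φ i (idx (Classical.arbitrary X))) h₁
    have hs : ∃ s : Fin d → Fin (Fintype.card X), ∀ x ∈ e, s (ψ (π x)) = idx x := by
      refine ⟨fun i => idx (Function.invFunOn (ψ ∘ π) e i), fun x hx => ?_⟩
      exact congrArg idx (hinj'.leftInvOn_invFunOn hx)
    obtain ⟨s, hs⟩ := hs
    have h₂ := (hA _ (hΦ s)) _ (hπ e he)
    rw [Finset.image_image] at h₂
    convert h₂ using 1
    refine Finset.image_congr fun x hx => ?_
    simp [hs x hx]

section Sampling

/-- Sampling three vertices through a random map `φ` is the same as sampling them directly. -/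
lemma sum_comp_triple {m n : ℕ} (A : Fin n → Fin n → Fin n → ℝ) {i j k : Fin m}
    (hij : i ≠ j) (hik : i ≠ k) (hjk : j ≠ k) :
    (n : ℝ) ^ 3 * ∑ φ : Fin m → Fin n, A (φ i) (φ j) (φ k) =
      (n : ℝ) ^ m * ∑ x, ∑ y, ∑ z, A x y z := by
  -- Exchange the values of `φ` at `i`, `j`, `k` with an independent triple of vertices.
  let T : (Fin m → Fin n) × Fin n × Fin n × Fin n → (Fin m → Fin n) × Fin n × Fin n × Fin n :=
    fun p => (Function.update (Function.update (Function.update p.1 i p.2.1) j p.2.2.1) k p.2.2.2,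
      p.1 i, p.1 j, p.1 k)
  have hT : Function.Involutive T := by
    rintro ⟨φ, x, y, z⟩
    simp only [T, Prod.mk.injEq]
    refine ⟨?_, ?_, ?_, ?_⟩
    · funext l
      by_cases hk : l = k
      · subst hk; simp
      by_cases hj : l = j
      · subst hj; simp [hk]
      by_cases hi : l = i
      · subst hi; simp [hk, hj]
      simp [hk, hj, hi]
    · simp [hij, hik]
    · simp [hjk]
    · simp
  have h := Equiv.sum_comp hT.toPerm fun p => A p.2.1 p.2.2.1 p.2.2.2
  simp only [Function.Involutive.coe_toPerm, T, Fintype.sum_prod_type] at h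
  simp only [Finset.sum_const, Finset.card_univ, Fintype.card_fun, Fintype.card_fin, nsmul_eq_mul]
    at h
  rw [← Finset.mul_sum] at h
  push_cast at h
  simp only [← Finset.mul_sum] at h
  rw [← h]
  ring

lemma six_mul_card_le_sum_adj {V : Type*} [Fintype V] [DecidableEq V] (H : RGraph 3 V) :
    6 * (H.edges.card : ℝ) ≤ ∑ i, ∑ j, ∑ k, H.adj i j k := by
  have h : ∑ i, ∑ j, ∑ k, H.adj i j k =
      ((Finset.univ.filter fun p : V × V × V => {p.1, p.2.1, p.2.2} ∈ H.edges).card : ℝ) := by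
    simp only [adj, Finset.card_filter, Fintype.sum_prod_type]
    push_cast
    rfl
  rw [h]
  have hfib := Finset.mul_card_image_le_card_of_maps_to
    (s := Finset.univ.filter fun p : V × V × V => {p.1, p.2.1, p.2.2} ∈ H.edges)
    (t := H.edges) (f := fun p => {p.1, p.2.1, p.2.2}) (by intro p hp; simpa using hp) 6 ?_
  · exact_mod_cast hfib
  · intro e he
    obtain ⟨a, b, c, hab, hac, hbc, rfl⟩ := Finset.card_eq_three.mp (H.card_eq e he)
    have h6 : ({(a, b, c), (a, c, b), (b, a, c), (b, c, a), (c, a, b), (c, b, a)} :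
        Finset (V × V × V)).card = 6 := by
      simp [hab, hac, hbc, hab.symm, hac.symm, hbc.symm]
    rw [← h6]
    refine Finset.card_le_card fun p hp => ?_
    have hperm : ({p.1, p.2.1, p.2.2} : Finset V) = {a, b, c} := by
      simp only [Finset.mem_insert, Finset.mem_singleton] at hp
      rcases hp with rfl | rfl | rfl | rfl | rfl | rfl <;> grind
    simp only [Finset.mem_filter, Finset.mem_univ, true_and, hperm, and_true]
    exact he

/-- The maps `φ : Fin m → Fin n` along which the pullback of `H` receives a homomorphism from
`K₄⁻` or `F⋆`. -/
noncomputable def goodMaps (m : ℕ) {n : ℕ} (H : RGraph 3 (Fin n)) : Finset (Fin m → Fin n) :=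
  open Classical in Finset.univ.filter fun φ =>
    (∃ ψ, K4minus.IsHom (comap φ H) ψ) ∨ ∃ ψ, FStar.IsHom (comap φ H) ψ

/-- A random induced subgraph on `m` sampled vertices has the edge density of `H` on average, up to
repetitions among the samples, and density at most `2 / 9` unless the sampling map is good. -/
lemma sum_adj_mul_le (m : ℕ) {n : ℕ} (hn : 0 < n) (H : RGraph 3 (Fin n)) :
    ((m : ℝ) ^ 3 - 3 * (m : ℝ) ^ 2) * ((n : ℝ) ^ m * ((∑ x, ∑ y, ∑ z, H.adj x y z) / (n : ℝ) ^ 3)) ≤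
      2 / 9 * (m : ℝ) ^ 3 * (n : ℝ) ^ m + (m : ℝ) ^ 3 * (goodMaps m H).card := by
  have hn' : (0 : ℝ) < n := by exact_mod_cast hn
  set C : ℝ := (n : ℝ) ^ m * ((∑ x, ∑ y, ∑ z, H.adj x y z) / (n : ℝ) ^ 3) with hC
  have hC0 : 0 ≤ C := mul_nonneg (by positivity) (div_nonneg (Finset.sum_nonneg fun i _ =>
    Finset.sum_nonneg fun j _ => Finset.sum_nonneg fun k _ => adj_nonneg _ _ _) (by positivity))
  have hlow : ∀ i j k : Fin m, ((1 : ℝ) - (if i = j then 1 else 0) - (if i = k then 1 else 0) -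
      (if j = k then 1 else 0)) * C ≤ ∑ φ : Fin m → Fin n, H.adj (φ i) (φ j) (φ k) := by
    intro i j k
    have h0 : 0 ≤ ∑ φ : Fin m → Fin n, H.adj (φ i) (φ j) (φ k) :=
      Finset.sum_nonneg fun φ _ => adj_nonneg _ _ _
    by_cases hij : i = j
    · refine le_trans (mul_nonpos_of_nonpos_of_nonneg ?_ hC0) h0
      rw [if_pos hij]; split_ifs <;> norm_num
    by_cases hik : i = k
    · refine le_trans (mul_nonpos_of_nonpos_of_nonneg ?_ hC0) h0
      rw [if_neg hij, if_pos hik]; split_ifs <;> norm_num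
    by_cases hjk : j = k
    · refine le_trans (mul_nonpos_of_nonpos_of_nonneg ?_ hC0) h0
      rw [if_neg hij, if_neg hik, if_pos hjk]; norm_num
    have h := sum_comp_triple H.adj hij hik hjk
    rw [if_neg hij, if_neg hik, if_neg hjk, hC]
    refine le_of_eq ?_
    field_simp
    linarith
  calc ((m : ℝ) ^ 3 - 3 * (m : ℝ) ^ 2) * C
      = ∑ i : Fin m, ∑ j : Fin m, ∑ k : Fin m, ((1 : ℝ) - (if i = j then 1 else 0) -
          (if i = k then 1 else 0) - (if j = k then 1 else 0)) * C := by
        simp only [← Finset.sum_mul]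
        congr 1
        simp [Finset.sum_sub_distrib]
        ring
    _ ≤ ∑ i : Fin m, ∑ j : Fin m, ∑ k : Fin m, ∑ φ : Fin m → Fin n, H.adj (φ i) (φ j) (φ k) :=
        Finset.sum_le_sum fun i _ => Finset.sum_le_sum fun j _ => Finset.sum_le_sum fun k _ =>
          hlow i j k
    _ = ∑ φ : Fin m → Fin n, ∑ i, ∑ j, ∑ k, (comap φ H).adj i j k := by
        simp only [adj_comap]
        symm
        refine Finset.sum_comm.trans (Finset.sum_congr rfl fun i _ => ?_)
        exact Finset.sum_comm.trans (Finset.sum_congr rfl fun j _ => Finset.sum_comm)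
    _ ≤ ∑ φ : Fin m → Fin n, (2 / 9 * (m : ℝ) ^ 3 +
          (m : ℝ) ^ 3 * if φ ∈ goodMaps m H then 1 else 0) := by
        refine Finset.sum_le_sum fun φ _ => ?_
        by_cases hφ : φ ∈ goodMaps m H
        · have h : ∑ i, ∑ j, ∑ k, (comap φ H).adj i j k ≤
              ∑ i : Fin m, ∑ j : Fin m, ∑ k : Fin m, (1 : ℝ) := by
            refine Finset.sum_le_sum fun i _ => Finset.sum_le_sum fun j _ =>
              Finset.sum_le_sum fun k _ => ?_
            unfold adj; split_ifs <;> norm_num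
          rw [if_pos hφ]
          have e : ∑ i : Fin m, ∑ j : Fin m, ∑ k : Fin m, (1 : ℝ) = (m : ℝ) ^ 3 := by
            simp; ring
          rw [e] at h
          linarith [show (0 : ℝ) ≤ (m : ℝ) ^ 3 by positivity]
        · rw [if_neg hφ]
          simp only [goodMaps, Finset.mem_filter, Finset.mem_univ, true_and, not_or,
            not_exists] at hφ
          have h := sum_adj_le hφ.1 hφ.2
          rw [Fintype.card_fin] at h
          linarith
    _ = _ := by
        rw [Finset.sum_add_distrib, ← Finset.mul_sum]
        simp
        ring

/-- Few homomorphisms through each fixed pattern `ψ` leave few good maps. -/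
lemma card_goodMaps_le (m : ℕ) {n : ℕ} (H : RGraph 3 (Fin n)) {b : ℝ}
    (hK : ∀ (ψ : Fin 4 → Fin m) (A : Finset (Fin m → Fin n)),
      (∀ φ ∈ A, K4minus.IsHom H (φ ∘ ψ)) → (A.card : ℝ) ≤ b)
    (hF : ∀ (ψ : Fin 7 → Fin m) (A : Finset (Fin m → Fin n)),
      (∀ φ ∈ A, FStar.IsHom H (φ ∘ ψ)) → (A.card : ℝ) ≤ b) :
    ((goodMaps m H).card : ℝ) ≤ ((m : ℝ) ^ 4 + (m : ℝ) ^ 7) * b := by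
  classical
  let A : (Fin 4 → Fin m) → Finset (Fin m → Fin n) := fun ψ =>
    Finset.univ.filter fun φ => K4minus.IsHom H (φ ∘ ψ)
  let B : (Fin 7 → Fin m) → Finset (Fin m → Fin n) := fun ψ =>
    Finset.univ.filter fun φ => FStar.IsHom H (φ ∘ ψ)
  have hsub : goodMaps m H ⊆ Finset.univ.biUnion A ∪ Finset.univ.biUnion B := by
    intro φ hφ
    simp only [goodMaps, Finset.mem_filter, Finset.mem_univ, true_and] at hφ
    simp only [Finset.mem_union, Finset.mem_biUnion, Finset.mem_univ, true_and, A, B,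
      Finset.mem_filter]
    exact hφ.imp (fun ⟨ψ, h⟩ => ⟨ψ, h.comp_comap⟩) fun ⟨ψ, h⟩ => ⟨ψ, h.comp_comap⟩
  have hcard : (goodMaps m H).card ≤ ∑ ψ, (A ψ).card + ∑ ψ, (B ψ).card :=
    (Finset.card_le_card hsub).trans ((Finset.card_union_le _ _).trans
      (add_le_add Finset.card_biUnion_le Finset.card_biUnion_le))
  calc ((goodMaps m H).card : ℝ) ≤ ∑ ψ, ((A ψ).card : ℝ) + ∑ ψ, ((B ψ).card : ℝ) := by
        exact_mod_cast hcard
    _ ≤ ∑ ψ : Fin 4 → Fin m, b + ∑ ψ : Fin 7 → Fin m, b := by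
        refine add_le_add (Finset.sum_le_sum fun ψ _ => ?_) (Finset.sum_le_sum fun ψ _ => ?_)
        · exact hK ψ (A ψ) fun φ hφ => (Finset.mem_filter.mp hφ).2
        · exact hF ψ (B ψ) fun φ hφ => (Finset.mem_filter.mp hφ).2
    _ = _ := by simp; ring

/-- The asymptotic upper bound on the number of edges of a `productF`-free `3`-graph. -/
theorem card_edges_le_of_isFree {η : ℝ} (hη : 0 < η) :
    ∃ n₀ : ℕ, ∀ n : ℕ, n₀ ≤ n → ∀ H : RGraph 3 (Fin n), H.IsFree productF →
      6 * (H.edges.card : ℝ) ≤ (2 / 9 + η) * (n : ℝ) ^ 3 := by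
  -- `m` is so large that `(2 / 9 + η) (m ^ 3 - 3 m ^ 2) ≥ (2 / 9 + η / 2) m ^ 3`.
  obtain ⟨m, hm⟩ := exists_nat_gt (6 * (2 / 9 + η) / η)
  have hm0 : (0 : ℝ) < m := lt_trans (by positivity) hm
  rw [div_lt_iff₀ hη] at hm
  set c : ℝ := η / 4 / ((m : ℝ) ^ 4 + (m : ℝ) ^ 7) with hc
  have hcpos : 0 < c := by positivity
  obtain ⟨n₁, h₁⟩ := contains_of_many_homs (prod_isHom_fst K4minus FStar) m hcpos
  obtain ⟨n₂, h₂⟩ := contains_of_many_homs (prod_isHom_snd K4minus FStar) m hcpos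
  refine ⟨max (max n₁ n₂) 1, fun n hn H hH => ?_⟩
  simp only [max_le_iff] at hn
  have hn0 : (0 : ℝ) < n := by exact_mod_cast hn.2
  have hgood := card_goodMaps_le m H (b := c * (n : ℝ) ^ m)
    (fun ψ A hA => le_of_not_ge fun h => hH (h₁ n hn.1.1 H ψ A hA h))
    (fun ψ A hA => le_of_not_ge fun h => hH (h₂ n hn.1.2 H ψ A hA h))
  have hgood' : ((goodMaps m H).card : ℝ) ≤ η / 4 * (n : ℝ) ^ m := by
    refine hgood.trans (le_of_eq ?_)
    rw [hc]; field_simp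
  have hmain := sum_adj_mul_le m hn.2 H
  refine (six_mul_card_le_sum_adj H).trans ?_
  by_contra! hlt
  set S := ∑ x, ∑ y, ∑ z, H.adj x y z with hS
  have hτ : 2 / 9 + η < S / (n : ℝ) ^ 3 := by
    rw [lt_div_iff₀ (by positivity)]; exact hlt
  set τ := S / (n : ℝ) ^ 3 with hτ_def
  have hN : (0 : ℝ) < (n : ℝ) ^ m := by positivity
  have h3 : ((m : ℝ) ^ 3 - 3 * (m : ℝ) ^ 2) * τ ≤ (2 / 9 + η / 4) * (m : ℝ) ^ 3 := by
    refine le_of_mul_le_mul_right ?_ hN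
    nlinarith [mul_le_mul_of_nonneg_left hgood' (show (0 : ℝ) ≤ (m : ℝ) ^ 3 by positivity)]
  have hm3 : 0 < (m : ℝ) - 3 := by nlinarith
  have h4 : ((m : ℝ) - 3) * τ ≤ (2 / 9 + η / 4) * m := by
    refine le_of_mul_le_mul_right ?_ (show (0 : ℝ) < (m : ℝ) ^ 2 by positivity)
    nlinarith
  have h5 : ((m : ℝ) - 3) * (2 / 9 + η) < ((m : ℝ) - 3) * τ := mul_lt_mul_of_pos_left hτ hm3
  nlinarith

end Sampling
end RGraph

/-! ### The two-bipartition `3`-graphs -/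

section TwoCuts

/-- The side of the vertex `u = (b₁, b₂, i)` in the bipartition attached to `w`: the first
coordinate `b₁` if `w < j`, the second coordinate `b₂` otherwise. -/
def cutSide {N : ℕ} (j : ℕ) (w : Fin (2 * N)) (u : Bool × Bool × Fin N) : Bool :=
  if (w : ℕ) < j then u.1 else u.2.1

/-- The `3`-graph on `W ∪ U`, with `|W| = 2N` and `|U| = 4N`, in which the link of every `w ∈ W` is
a balanced complete bipartite graph on `U`. Two bipartitions of `U` occur, splitting `U` into four
parts of size `N`: the first `j` vertices of `W` use one of them, the other `2N - j` vertices use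
the other. -/
def twoCuts (N j : ℕ) : RGraph 3 (Fin (2 * N) ⊕ Bool × Bool × Fin N) where
  edges := (Finset.univ.filter fun
      p : Fin (2 * N) × (Bool × Bool × Fin N) × (Bool × Bool × Fin N) =>
    cutSide j p.1 p.2.1 = false ∧ cutSide j p.1 p.2.2 = true).image
      fun p => {Sum.inl p.1, Sum.inr p.2.1, Sum.inr p.2.2}
  card_eq := by
    intro e he
    obtain ⟨⟨w, u, u'⟩, hp, rfl⟩ := Finset.mem_image.mp he
    have h := (Finset.mem_filter.mp hp).2
    have hne : u ≠ u' := by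
      rintro rfl
      simp_all
    exact Finset.card_triple_eq_three_iff.mpr (by simp [hne])

variable {N j : ℕ}

lemma mem_twoCuts_edges {e : Finset (Fin (2 * N) ⊕ Bool × Bool × Fin N)} :
    e ∈ (twoCuts N j).edges ↔ ∃ w u u', cutSide j w u = false ∧ cutSide j w u' = true ∧
      e = {Sum.inl w, Sum.inr u, Sum.inr u'} := by
  simp only [twoCuts, Finset.mem_image, Finset.mem_filter, Finset.mem_univ, true_and]
  exact ⟨fun ⟨⟨w, u, u'⟩, h, he⟩ => ⟨w, u, u', h.1, h.2, he.symm⟩,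
    fun ⟨w, u, u', h, h', he⟩ => ⟨⟨w, u, u'⟩, ⟨h, h'⟩, he.symm⟩⟩

lemma inl_inr_inr_mem_twoCuts_edges {w : Fin (2 * N)} {u u' : Bool × Bool × Fin N} :
    {Sum.inl w, Sum.inr u, Sum.inr u'} ∈ (twoCuts N j).edges ↔ cutSide j w u ≠ cutSide j w u' := by
  rw [mem_twoCuts_edges]
  constructor
  · rintro ⟨w', v, v', hv, hv', h⟩
    have hw : w = w' := by
      have : (Sum.inl w : Fin (2 * N) ⊕ Bool × Bool × Fin N) ∈
          ({Sum.inl w', Sum.inr v, Sum.inr v'} : Finset _) := by rw [← h]; simp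
      simpa using this
    have hu : u = v ∨ u = v' := by
      have : (Sum.inr u : Fin (2 * N) ⊕ Bool × Bool × Fin N) ∈
          ({Sum.inl w', Sum.inr v, Sum.inr v'} : Finset _) := by rw [← h]; simp
      simpa using this
    have hu' : u' = v ∨ u' = v' := by
      have : (Sum.inr u' : Fin (2 * N) ⊕ Bool × Bool × Fin N) ∈
          ({Sum.inl w', Sum.inr v, Sum.inr v'} : Finset _) := by rw [← h]; simp
      simpa using this
    have hvu : v = u ∨ v = u' := by
      have : (Sum.inr v : Fin (2 * N) ⊕ Bool × Bool × Fin N) ∈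
          ({Sum.inl w, Sum.inr u, Sum.inr u'} : Finset _) := by rw [h]; simp
      simpa using this
    have hvu' : v' = u ∨ v' = u' := by
      have : (Sum.inr v' : Fin (2 * N) ⊕ Bool × Bool × Fin N) ∈
          ({Sum.inl w, Sum.inr u, Sum.inr u'} : Finset _) := by rw [h]; simp
      simpa using this
    subst hw
    intro heq
    rcases hu with rfl | rfl <;> rcases hu' with rfl | rfl <;> simp_all
  · intro h
    cases hu : cutSide j w u
    · refine ⟨w, u, u', hu, ?_, rfl⟩
      rw [hu] at h
      simpa using h.symm
    · refine ⟨w, u', u, ?_, hu, by rw [Finset.pair_comm]⟩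
      rw [hu] at h
      simpa using h.symm

/-- Every edge has exactly one vertex in `W`. -/
lemma sum_isLeft_of_mem_twoCuts_edges {x y z : Fin (2 * N) ⊕ Bool × Bool × Fin N}
    (h : {x, y, z} ∈ (twoCuts N j).edges) :
    (if x.isLeft then 1 else 0) + (if y.isLeft then 1 else 0) +
      (if z.isLeft then 1 else 0) = 1 := by
  obtain ⟨hxy, hxz, hyz⟩ := RGraph.ne_of_mem_edges h
  obtain ⟨w, u, u', -, -, he⟩ := mem_twoCuts_edges.mp h
  have hsum : ∑ v ∈ ({x, y, z} : Finset (Fin (2 * N) ⊕ Bool × Bool × Fin N)),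
      (if v.isLeft then 1 else 0) = 1 := by
    rw [he, Finset.sum_insert (by simp), Finset.sum_eq_zero] <;> simp
  rw [Finset.sum_insert (by simp [hxy, hxz]), Finset.sum_pair hyz] at hsum
  omega

lemma inl_inl_notMem_twoCuts_edges {w w' : Fin (2 * N)} {z : Fin (2 * N) ⊕ Bool × Bool × Fin N} :
    {Sum.inl w, Sum.inl w', z} ∉ (twoCuts N j).edges := by
  intro h
  have := sum_isLeft_of_mem_twoCuts_edges h
  simp only [Sum.isLeft_inl, if_true] at this
  omega

lemma inr_inr_inr_notMem_twoCuts_edges {u u' u'' : Bool × Bool × Fin N} :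
    {Sum.inr u, Sum.inr u', Sum.inr u''} ∉ (twoCuts N j).edges := by
  intro h
  have := sum_isLeft_of_mem_twoCuts_edges h
  simp at this

lemma card_filter_cutSide (w : Fin (2 * N)) (b : Bool) :
    (Finset.univ.filter fun u : Bool × Bool × Fin N => cutSide j w u = b).card = 2 * N := by
  rw [Finset.card_filter]
  simp only [Fintype.sum_prod_type, Fintype.sum_bool, cutSide]
  by_cases h : (w : ℕ) < j <;> cases b <;> simp [h] <;> ring

lemma card_twoCuts_edges (N j : ℕ) : (twoCuts N j).edges.card = 8 * N ^ 3 := by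
  unfold twoCuts
  rw [Finset.card_image_of_injOn]
  · have h : (Finset.univ.filter fun
          p : Fin (2 * N) × (Bool × Bool × Fin N) × (Bool × Bool × Fin N) =>
        cutSide j p.1 p.2.1 = false ∧ cutSide j p.1 p.2.2 = true) =
        Finset.univ.biUnion fun w : Fin (2 * N) => {w} ×ˢ
          ((Finset.univ.filter fun u => cutSide j w u = false) ×ˢ
            (Finset.univ.filter fun u => cutSide j w u = true)) := by
      ext ⟨w, u, u'⟩
      simp only [Finset.mem_filter, Finset.mem_univ, true_and, Finset.mem_biUnion,
        Finset.mem_product, Finset.mem_singleton]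
      exact ⟨fun h => ⟨w, rfl, h⟩, by rintro ⟨w', rfl, h⟩; exact h⟩
    rw [h, Finset.card_biUnion]
    · simp only [Finset.card_product, Finset.card_singleton, card_filter_cutSide]
      simp
      ring
    · intro w _ w' _ hww'
      refine Finset.disjoint_left.mpr ?_
      rintro ⟨x, u, u'⟩ h₁ h₂
      simp only [Finset.mem_product, Finset.mem_singleton] at h₁ h₂
      exact hww' (h₁.1.symm.trans h₂.1)
  · rintro ⟨w, u, u'⟩ h ⟨v, t, t'⟩ h' heq
    simp only [Finset.coe_filter, Finset.mem_univ, true_and, Set.mem_ofPred_eq] at h h'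
    dsimp only at heq
    have hw : w = v := by
      have : (Sum.inl w : Fin (2 * N) ⊕ Bool × Bool × Fin N) ∈
          ({Sum.inl v, Sum.inr t, Sum.inr t'} : Finset _) := by rw [← heq]; simp
      simpa using this
    have hu : u = t ∨ u = t' := by
      have : (Sum.inr u : Fin (2 * N) ⊕ Bool × Bool × Fin N) ∈
          ({Sum.inl v, Sum.inr t, Sum.inr t'} : Finset _) := by rw [← heq]; simp
      simpa using this
    have hu' : u' = t ∨ u' = t' := by
      have : (Sum.inr u' : Fin (2 * N) ⊕ Bool × Bool × Fin N) ∈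
          ({Sum.inl v, Sum.inr t, Sum.inr t'} : Finset _) := by rw [← heq]; simp
      simpa using this
    subst hw
    rcases hu with rfl | rfl <;> rcases hu' with rfl | rfl <;> simp_all

/-! ### There is no homomorphism from `K₄⁻ × F⋆` to a two-bipartition `3`-graph -/

lemma mem_productF_edges {p₁ p₂ p₃ : Fin 4} {q₁ q₂ q₃ : Fin 7}
    (hp : {p₁, p₂, p₃} ∈ K4minus.edges) (hq : {q₁, q₂, q₃} ∈ FStar.edges) :
    {(p₁, q₁), (p₂, q₂), (p₃, q₃)} ∈ productF.edges := by
  obtain ⟨h₁, h₂, h₃⟩ := RGraph.ne_of_mem_edges hp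
  simp only [productF, RGraph.prod, Finset.mem_filter, Finset.mem_powersetCard,
    Finset.subset_univ, true_and, Finset.image_insert, Finset.image_singleton]
  exact ⟨Finset.card_triple_eq_three_iff.mpr (by simp [h₁, h₂, h₃]), hp, hq⟩

/-- A `0/1`-labelling of the product of `K₄⁻` with a single edge `{x, y, z}` in which every edge has
exactly one label `1`: either the labels `1` form the row of the apex of `K₄⁻`, or the labelling
depends only on the coordinate in `{x, y, z}`. -/
lemma row_or_column {x y z : Fin 4 → ℕ}
    (h : ∀ p₁ p₂ p₃, {p₁, p₂, p₃} ∈ K4minus.edges → x p₁ + y p₂ + z p₃ = 1) :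
    ((x 0 = 1 ∧ y 0 = 1 ∧ z 0 = 1) ∧ (∀ p, p ≠ 0 → x p = 0 ∧ y p = 0 ∧ z p = 0)) ∨
      ∀ p, x p = x 0 ∧ y p = y 0 ∧ z p = z 0 := by
  have a₁ := h 0 1 2 (by decide)
  have a₂ := h 0 2 1 (by decide)
  have a₃ := h 1 0 2 (by decide)
  have a₄ := h 1 2 0 (by decide)
  have a₅ := h 2 0 1 (by decide)
  have a₆ := h 2 1 0 (by decide)
  have b₁ := h 0 1 3 (by decide)
  have b₂ := h 0 3 1 (by decide)
  have b₃ := h 1 0 3 (by decide)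
  have b₄ := h 1 3 0 (by decide)
  have b₅ := h 3 0 1 (by decide)
  have b₆ := h 3 1 0 (by decide)
  have c₁ := h 0 2 3 (by decide)
  have c₂ := h 0 3 2 (by decide)
  have c₃ := h 2 0 3 (by decide)
  have c₄ := h 2 3 0 (by decide)
  have c₅ := h 3 0 2 (by decide)
  have c₆ := h 3 2 0 (by decide)
  clear h
  by_cases hrow : x 0 = 1 ∧ y 0 = 1 ∧ z 0 = 1
  · refine Or.inl ⟨hrow, fun p hp => ?_⟩
    obtain ⟨h₁, h₂, h₃⟩ := hrow
    fin_cases p <;> simp at hp ⊢ <;> omega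
  · have hx : x 1 = x 0 ∧ x 2 = x 0 ∧ x 3 = x 0 := by omega
    have hy : y 1 = y 0 ∧ y 2 = y 0 ∧ y 3 = y 0 := by omega
    have hz : z 1 = z 0 ∧ z 2 = z 0 ∧ z 3 = z 0 := by omega
    refine Or.inr fun p => ?_
    fin_cases p <;> simp [hx, hy, hz]

/-- Every labelling of `K₄⁻ × F⋆` with exactly one label `1` on each edge is, on the part of `F⋆`
spanned by `F₅`, the labelling of the row of the apex of `K₄⁻`: otherwise it would come from a set
of vertices of `F⋆` meeting each edge exactly once, and there is none. -/
lemma apex_row_of_sum_eq_one {c : Fin 4 → Fin 7 → ℕ}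
    (h : ∀ p₁ p₂ p₃ q₁ q₂ q₃, {p₁, p₂, p₃} ∈ K4minus.edges → {q₁, q₂, q₃} ∈ FStar.edges →
      c p₁ q₁ + c p₂ q₂ + c p₃ q₃ = 1) (q : Fin 7) (hq : q < 5) :
    c 0 q = 1 ∧ ∀ p, p ≠ 0 → c p q = 0 := by
  have hexcl : ∀ q, (c 0 q = 1 ∧ ∀ p, p ≠ 0 → c p q = 0) → ¬ ∀ p, c p q = c 0 q := by
    intro q hr hc
    have h₁ := hr.2 1 (by decide)
    rw [hc 1, hr.1] at h₁
    exact one_ne_zero h₁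
  have e : ∀ q₁ q₂ q₃, {q₁, q₂, q₃} ∈ FStar.edges →
      ((c 0 q₁ = 1 ∧ ∀ p, p ≠ 0 → c p q₁ = 0) ∧ (c 0 q₂ = 1 ∧ ∀ p, p ≠ 0 → c p q₂ = 0) ∧
        (c 0 q₃ = 1 ∧ ∀ p, p ≠ 0 → c p q₃ = 0)) ∨
      ((∀ p, c p q₁ = c 0 q₁) ∧ (∀ p, c p q₂ = c 0 q₂) ∧ (∀ p, c p q₃ = c 0 q₃) ∧
        c 0 q₁ + c 0 q₂ + c 0 q₃ = 1) := by
    intro q₁ q₂ q₃ hq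
    rcases row_or_column (x := fun p => c p q₁) (y := fun p => c p q₂) (z := fun p => c p q₃)
      fun p₁ p₂ p₃ hp => h p₁ p₂ p₃ q₁ q₂ q₃ hp hq with ⟨⟨h₁, h₂, h₃⟩, h'⟩ | h'
    · exact Or.inl ⟨⟨h₁, fun p hp => (h' p hp).1⟩, ⟨h₂, fun p hp => (h' p hp).2.1⟩,
        ⟨h₃, fun p hp => (h' p hp).2.2⟩⟩
    · refine Or.inr ⟨fun p => (h' p).1, fun p => (h' p).2.1, fun p => (h' p).2.2, ?_⟩
      have h₁ := h 0 1 2 q₁ q₂ q₃ (by decide) hq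
      rwa [(h' 1).2.1, (h' 2).2.2] at h₁
  have e₁ := e 0 1 2 (by decide)
  have e₂ := e 0 1 3 (by decide)
  have e₃ := e 2 3 4 (by decide)
  have e₄ := e 0 4 5 (by decide)
  have e₅ := e 1 4 6 (by decide)
  rcases e₁ with ⟨r₀, r₁, r₂⟩ | ⟨c₀, c₁, c₂, s₁⟩
  · obtain ⟨-, -, r₃⟩ := e₂.resolve_right fun h' => hexcl 0 r₀ h'.1
    obtain ⟨-, -, r₄⟩ := e₃.resolve_right fun h' => hexcl 2 r₂ h'.1
    fin_cases q
    exacts [r₀, r₁, r₂, r₃, r₄, absurd hq (by decide), absurd hq (by decide)]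
  · exfalso
    have s₂ := (e₂.resolve_left fun h' => hexcl 0 h'.1 c₀).2.2.2
    have s₃ := (e₃.resolve_left fun h' => hexcl 2 h'.1 c₂).2.2.2
    have s₄ := (e₄.resolve_left fun h' => hexcl 0 h'.1 c₀).2.2.2
    have s₅ := (e₅.resolve_left fun h' => hexcl 1 h'.1 c₁).2.2.2
    omega

/-- The conditions on `F₅ = {012, 013, 234}` that a homomorphism would satisfy cannot hold: with
`i q` the choice of a bipartition by the vertex `q` and `(a q, b q)` the position of `q`, the two
other vertices of each edge at `q` lie on different sides of the bipartition `i q`. -/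
lemma no_F5_sides (i a b : Fin 7 → Bool)
    (h : ∀ q₁ q₂ q₃, {q₁, q₂, q₃} ∈ FStar.edges → q₁ < 5 → q₂ < 5 → q₃ < 5 →
      (if i q₁ then a q₂ else b q₂) ≠ (if i q₁ then a q₃ else b q₃)) : False := by
  have a₁ := h 0 1 2 (by decide) (by decide) (by decide) (by decide)
  have a₂ := h 1 0 2 (by decide) (by decide) (by decide) (by decide)
  have a₃ := h 2 0 1 (by decide) (by decide) (by decide) (by decide)
  have b₁ := h 0 1 3 (by decide) (by decide) (by decide) (by decide)
  have b₂ := h 1 0 3 (by decide) (by decide) (by decide) (by decide)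
  have b₃ := h 3 0 1 (by decide) (by decide) (by decide) (by decide)
  have c₁ := h 2 3 4 (by decide) (by decide) (by decide) (by decide)
  have c₂ := h 3 2 4 (by decide) (by decide) (by decide) (by decide)
  have c₃ := h 4 2 3 (by decide) (by decide) (by decide) (by decide)
  clear h
  have key : ∀ i₀ a₁ b₁ a₂ b₂ : Bool, ((if i₀ then a₁ else b₁) ≠ if i₀ then a₂ else b₂) →
      ∀ i₁ a₀ b₀ : Bool, ((if i₁ then a₀ else b₀) ≠ if i₁ then a₂ else b₂) →
      ∀ i₂ a₃ b₃ : Bool, ((if i₂ then a₀ else b₀) ≠ if i₂ then a₁ else b₁) ∧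
        ((if i₀ then a₁ else b₁) ≠ if i₀ then a₃ else b₃) ∧
        ((if i₁ then a₀ else b₀) ≠ if i₁ then a₃ else b₃) →
      ∀ i₃ i₄ : Bool, ((if i₃ then a₀ else b₀) ≠ if i₃ then a₁ else b₁) ∧
        ((if i₄ then a₂ else b₂) ≠ if i₄ then a₃ else b₃) →
      ∀ a₄ b₄ : Bool, ¬ (((if i₂ then a₃ else b₃) ≠ if i₂ then a₄ else b₄) ∧
        ((if i₃ then a₂ else b₂) ≠ if i₃ then a₄ else b₄)) := by
    decide +kernel
  exact key _ _ _ _ _ a₁ _ _ _ a₂ _ _ _ ⟨a₃, b₁, b₂⟩ _ _ ⟨b₃, c₃⟩ _ _ ⟨c₁, c₂⟩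

theorem not_isHom_productF_twoCuts (N j : ℕ)
    (f : Fin 4 × Fin 7 → Fin (2 * N) ⊕ Bool × Bool × Fin N) :
    ¬ productF.IsHom (twoCuts N j) f := by
  intro hf
  have hedge : ∀ p₁ p₂ p₃ q₁ q₂ q₃, {p₁, p₂, p₃} ∈ K4minus.edges → {q₁, q₂, q₃} ∈ FStar.edges →
      {f (p₁, q₁), f (p₂, q₂), f (p₃, q₃)} ∈ (twoCuts N j).edges := by
    intro p₁ p₂ p₃ q₁ q₂ q₃ hp hq
    have h := hf _ (mem_productF_edges hp hq)
    simpa only [Finset.image_insert, Finset.image_singleton] using h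
  have hrow := apex_row_of_sum_eq_one (c := fun p q => if (f (p, q)).isLeft then 1 else 0)
    fun p₁ p₂ p₃ q₁ q₂ q₃ hp hq => sum_isLeft_of_mem_twoCuts_edges (hedge _ _ _ _ _ _ hp hq)
  have hw : ∀ q : Fin 7, ∃ i : Bool, q < 5 →
      ∃ w, f (0, q) = Sum.inl w ∧ i = decide ((w : ℕ) < j) := by
    intro q
    by_cases hq : q < 5
    · have h := (hrow q hq).1
      obtain ⟨w, hw⟩ := Sum.isLeft_iff.mp (show (f (0, q)).isLeft by simpa using h)
      exact ⟨_, fun _ => ⟨w, hw, rfl⟩⟩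
    · exact ⟨true, fun h => absurd h hq⟩
  choose i hi using hw
  have hu : ∀ (p : Fin 4) (q : Fin 7), ∃ a b : Bool, p ≠ 0 → q < 5 →
      ∃ t, f (p, q) = Sum.inr (a, b, t) := by
    intro p q
    by_cases hpq : p ≠ 0 ∧ q < 5
    · have h := (hrow q hpq.2).2 p hpq.1
      obtain ⟨⟨a, b, t⟩, hu⟩ := Sum.isRight_iff.mp (show (f (p, q)).isRight by simpa using h)
      exact ⟨a, b, fun _ _ => ⟨t, hu⟩⟩
    · exact ⟨true, true, fun h h' => absurd ⟨h, h'⟩ hpq⟩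
  choose a b hab using hu
  have hside : ∀ p p' : Fin 4, {0, p, p'} ∈ K4minus.edges → ∀ q₁ q₂ q₃,
      {q₁, q₂, q₃} ∈ FStar.edges → q₁ < 5 → q₂ < 5 → q₃ < 5 →
      (if i q₁ then a p q₂ else b p q₂) ≠ (if i q₁ then a p' q₃ else b p' q₃) := by
    intro p p' hp q₁ q₂ q₃ hq h₁ h₂ h₃
    obtain ⟨hp₁, hp₂, -⟩ := RGraph.ne_of_mem_edges hp
    obtain ⟨w, hw, hiw⟩ := hi q₁ h₁
    obtain ⟨t, ht⟩ := hab p q₂ hp₁.symm h₂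
    obtain ⟨t', ht'⟩ := hab p' q₃ hp₂.symm h₃
    have h := hedge 0 p p' q₁ q₂ q₃ hp hq
    rw [hw, ht, ht', inl_inr_inr_mem_twoCuts_edges] at h
    simpa [hiw, cutSide] using h
  refine no_F5_sides i (a 1) (b 1) fun q₁ q₂ q₃ hq h₁ h₂ h₃ => ?_
  -- The side changes three times along the walk `(1, q₂)`, `(2, q₃)`, `(3, q₂)`, `(1, q₃)`.
  have s₁ := hside 1 2 (by decide) q₁ q₂ q₃ hq h₁ h₂ h₃
  have s₂ := hside 3 2 (by decide) q₁ q₂ q₃ hq h₁ h₂ h₃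
  have s₃ := hside 3 1 (by decide) q₁ q₂ q₃ hq h₁ h₂ h₃
  revert s₁ s₂ s₃
  generalize (if i q₁ then a 1 q₂ else b 1 q₂) = x₁
  generalize (if i q₁ then a 2 q₃ else b 2 q₃) = x₂
  generalize (if i q₁ then a 3 q₂ else b 3 q₂) = x₃
  generalize (if i q₁ then a 1 q₃ else b 1 q₃) = x₄
  revert x₁ x₂ x₃ x₄
  decide

end TwoCuts

/-! ### The number of edges of `K₄⁻ × F⋆` -/

/-- The edges of `F⋆` as increasing triples. -/
def increasingEdges : Finset (Fin 7 × Fin 7 × Fin 7) :=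
  {(0, 1, 2), (0, 1, 3), (2, 3, 4), (0, 4, 5), (1, 4, 6)}

lemma increasing_mem_FStar {q : Fin 7 × Fin 7 × Fin 7}
    (hq : q ∈ increasingEdges) : {q.1, q.2.1, q.2.2} ∈ FStar.edges := by
  revert q
  decide +kernel

/-- The edges of the product, listed by the increasing orderings of the edges of `F⋆` and all
orderings of the edges of `K₄⁻`. -/
lemma productF_edges_eq_image :
    productF.edges = ((Finset.univ.filter fun p : Fin 4 × Fin 4 × Fin 4 =>
      {p.1, p.2.1, p.2.2} ∈ K4minus.edges) ×ˢ
        increasingEdges).image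
      fun x => {(x.1.1, x.2.1), (x.1.2.1, x.2.2.1), (x.1.2.2, x.2.2.2)} := by
  ext e
  simp only [Finset.mem_image, Finset.mem_product, Finset.mem_filter, Finset.mem_univ, true_and]
  constructor
  · intro he
    have hK : e.image Prod.fst ∈ K4minus.edges := RGraph.prod_isHom_fst _ _ e he
    have hF : e.image Prod.snd ∈ FStar.edges := RGraph.prod_isHom_snd _ _ e he
    have hq : ∃ q : Fin 7 × Fin 7 × Fin 7, q ∈ increasingEdges ∧
        e.image Prod.snd = {q.1, q.2.1, q.2.2} := by
      generalize e.image Prod.snd = s at hF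
      simp only [FStar, Finset.mem_insert, Finset.mem_singleton] at hF
      rcases hF with rfl | rfl | rfl | rfl | rfl
      · exact ⟨(0, 1, 2), by decide, rfl⟩
      · exact ⟨(0, 1, 3), by decide, rfl⟩
      · exact ⟨(2, 3, 4), by decide, rfl⟩
      · exact ⟨(0, 4, 5), by decide, rfl⟩
      · exact ⟨(1, 4, 6), by decide, rfl⟩
    obtain ⟨⟨q₁, q₂, q₃⟩, hq, himg⟩ := hq
    rw [himg] at hF
    obtain ⟨h₁₂, h₁₃, h₂₃⟩ := RGraph.ne_of_mem_edges hF
    have hmem : ∀ q ∈ ({q₁, q₂, q₃} : Finset (Fin 7)), ∃ p, (p, q) ∈ e := by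
      intro q hq
      rw [← himg] at hq
      obtain ⟨⟨p, q⟩, h, rfl⟩ := Finset.mem_image.mp hq
      exact ⟨p, h⟩
    obtain ⟨p₁, hp₁⟩ := hmem q₁ (by simp)
    obtain ⟨p₂, hp₂⟩ := hmem q₂ (by simp)
    obtain ⟨p₃, hp₃⟩ := hmem q₃ (by simp)
    have heq : {(p₁, q₁), (p₂, q₂), (p₃, q₃)} = e := by
      refine Finset.eq_of_subset_of_card_le ?_ ?_
      · intro x hx
        simp only [Finset.mem_insert, Finset.mem_singleton] at hx
        rcases hx with rfl | rfl | rfl <;> assumption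
      · rw [productF.card_eq e he, Finset.card_triple_eq_three_iff.mpr (by simp [h₁₂, h₁₃, h₂₃])]
    refine ⟨((p₁, p₂, p₃), (q₁, q₂, q₃)), ⟨?_, hq⟩, heq⟩
    rw [← heq] at hK
    simpa only [Finset.image_insert, Finset.image_singleton] using hK
  · rintro ⟨⟨⟨p₁, p₂, p₃⟩, ⟨q₁, q₂, q₃⟩⟩, ⟨hp, hq⟩, rfl⟩
    exact mem_productF_edges hp (increasing_mem_FStar hq)

lemma card_productF_edges : productF.edges.card = 90 := by
  rw [productF_edges_eq_image, Finset.card_image_of_injOn, Finset.card_product]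
  · decide +kernel
  · rintro ⟨⟨p₁, p₂, p₃⟩, ⟨q₁, q₂, q₃⟩⟩ hx ⟨⟨p₁', p₂', p₃'⟩, ⟨q₁', q₂', q₃'⟩⟩ hx' heq
    simp only [Finset.coe_product, Set.mem_prod, Finset.mem_coe] at hx hx'
    dsimp only at heq
    have hsnd := congrArg (Finset.image Prod.snd) heq
    simp only [Finset.image_insert, Finset.image_singleton] at hsnd
    have hinj : Set.InjOn (fun q : Fin 7 × Fin 7 × Fin 7 => ({q.1, q.2.1, q.2.2} : Finset (Fin 7)))
        increasingEdges := by
      rw [← Finset.card_image_iff]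
      decide
    have hq := hinj hx.2 hx'.2 hsnd
    have hF : {q₁, q₂, q₃} ∈ FStar.edges := increasing_mem_FStar hx.2
    obtain ⟨h₁₂, h₁₃, h₂₃⟩ := RGraph.ne_of_mem_edges hF
    simp only [Prod.mk.injEq] at hq
    obtain ⟨rfl, rfl, rfl⟩ := hq
    have h₁ : (p₁, q₁) ∈ ({(p₁', q₁), (p₂', q₂), (p₃', q₃)} : Finset (Fin 4 × Fin 7)) := by
      rw [← heq]; simp
    have h₂ : (p₂, q₂) ∈ ({(p₁', q₁), (p₂', q₂), (p₃', q₃)} : Finset (Fin 4 × Fin 7)) := by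
      rw [← heq]; simp
    have h₃ : (p₃, q₃) ∈ ({(p₁', q₁), (p₂', q₂), (p₃', q₃)} : Finset (Fin 4 × Fin 7)) := by
      rw [← heq]; simp
    simp [h₁₂, h₁₃, h₂₃, h₁₂.symm, h₁₃.symm, h₂₃.symm] at h₁ h₂ h₃
    simp [h₁, h₂, h₃]

/-! ### Transport to other vertex sets, and the Turán number -/

namespace RGraph

/-- The copy of an `r`-graph under an injection of its vertices; the vertices outside the range are
isolated. -/
def map {r : ℕ} {V W : Type*} [DecidableEq W] (ι : V ↪ W) (H : RGraph r V) : RGraph r W where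
  edges := H.edges.image (Finset.image ι)
  card_eq := by
    intro e he
    obtain ⟨e', he', rfl⟩ := Finset.mem_image.mp he
    rw [Finset.card_image_of_injective _ ι.injective, H.card_eq e' he']

section Map

variable {r : ℕ} {V W X : Type*} [DecidableEq W]

lemma card_map_edges (ι : V ↪ W) (H : RGraph r V) : (map ι H).edges.card = H.edges.card :=
  Finset.card_image_of_injective _ (Finset.image_injective ι.injective)

lemma IsHom.of_map [DecidableEq V] [Nonempty V] {F : RGraph r X} {H : RGraph r V}
    {ι : V ↪ W} {f : X → W}
    (h : F.IsHom (map ι H) f) : F.IsHom H (Function.invFun ι ∘ f) := by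
  intro e he
  obtain ⟨e', he', heq⟩ := Finset.mem_image.mp (h e he)
  rw [← Finset.image_image, ← heq, Finset.image_image,
    Function.invFun_comp ι.injective, Finset.image_id]
  exact he'

lemma isFree_map_of_not_isHom [DecidableEq V] [Nonempty V] {F : RGraph r X} {H : RGraph r V}
    (h : ∀ f, ¬ F.IsHom H f) (ι : V ↪ W) : (map ι H).IsFree F :=
  fun ⟨_, _, hf⟩ => h _ (IsHom.of_map hf)

end Map

lemma bddAbove_card_edges {r : ℕ} {W : Type*} (n : ℕ) (F : RGraph r W) :
    BddAbove {m : ℕ | ∃ H : RGraph r (Fin n), H.IsFree F ∧ H.edges.card = m} := by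
  refine ⟨Fintype.card (Finset (Fin n)), ?_⟩
  rintro m ⟨H, -, rfl⟩
  exact Finset.card_le_univ _

lemma card_le_turanNumber {r n : ℕ} {W : Type*} {F : RGraph r W} {H : RGraph r (Fin n)}
    (hH : H.IsFree F) : H.edges.card ≤ turanNumber n F :=
  le_csSup (bddAbove_card_edges n F) ⟨H, hH, rfl⟩

lemma turanNumber_le {r n : ℕ} {W : Type*} {F : RGraph r W} {b : ℝ} (hb : 0 ≤ b)
    (h : ∀ H : RGraph r (Fin n), H.IsFree F → (H.edges.card : ℝ) ≤ b) :
    (turanNumber n F : ℝ) ≤ b := by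
  unfold turanNumber
  rcases Set.eq_empty_or_nonempty {m : ℕ | ∃ H : RGraph r (Fin n), H.IsFree F ∧ H.edges.card = m}
    with h₀ | h₀
  · rw [h₀]; simpa using hb
  · obtain ⟨H, hH, hcard⟩ := Nat.sSup_mem h₀ (bddAbove_card_edges n F)
    rw [← hcard]
    exact h H hH

end RGraph

/-! ### The Turán density -/

lemma card_twoCuts_vertices (N : ℕ) : Fintype.card (Fin (2 * N) ⊕ Bool × Bool × Fin N) = 6 * N := by
  simp; ring

lemma eight_mul_pow_le_turanNumber (n : ℕ) : 8 * (n / 6) ^ 3 ≤ productF.turanNumber n := by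
  rcases Nat.eq_zero_or_pos (n / 6) with h | h
  · simp [h]
  · have : Nonempty (Fin (2 * (n / 6))) := ⟨⟨0, by omega⟩⟩
    obtain ⟨ι⟩ : Nonempty ((Fin (2 * (n / 6)) ⊕ Bool × Bool × Fin (n / 6)) ↪ Fin n) := by
      refine Function.Embedding.nonempty_of_card_le ?_
      rw [card_twoCuts_vertices, Fintype.card_fin]
      omega
    have hfree := RGraph.isFree_map_of_not_isHom (not_isHom_productF_twoCuts (n / 6) 0) ι
    rw [← card_twoCuts_edges (n / 6) 0, ← RGraph.card_map_edges ι]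
    exact RGraph.card_le_turanNumber hfree

lemma choose_three_eq (n : ℕ) : (n.choose 3 : ℝ) = n * (n - 1) * (n - 2) / 6 := by
  rw [Nat.cast_choose_eq_descPochhammer_div]
  simp [Nat.factorial, descPochhammer]
  ring

theorem hasTuranDensity_productF : productF.HasTuranDensity (2 / 9) := by
  unfold RGraph.HasTuranDensity
  have hinv : Tendsto (fun n : ℕ => (n : ℝ)⁻¹) atTop (𝓝 0) := tendsto_inv_atTop_nhds_zero_nat
  -- The normalizing factor `n ^ 3 / (6 * n.choose 3)`.
  have hnorm : Tendsto (fun n : ℕ => ((1 - (n : ℝ)⁻¹) * (1 - 2 * (n : ℝ)⁻¹))⁻¹) atTop (𝓝 1) := by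
    have h : Tendsto (fun n : ℕ => (1 - (n : ℝ)⁻¹) * (1 - 2 * (n : ℝ)⁻¹)) atTop
        (𝓝 ((1 - 0) * (1 - 2 * 0))) :=
      (tendsto_const_nhds.sub hinv).mul (tendsto_const_nhds.sub (hinv.const_mul 2))
    simpa using h.inv₀ (by norm_num)
  have hchoose : ∀ n : ℕ, 3 ≤ n →
      (n.choose 3 : ℝ) = (n : ℝ) ^ 3 / 6 * ((1 - (n : ℝ)⁻¹) * (1 - 2 * (n : ℝ)⁻¹)) := by
    intro n hn
    have hn0 : (n : ℝ) ≠ 0 := by positivity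
    rw [choose_three_eq]
    field_simp
  have hpos : ∀ n : ℕ, 3 ≤ n → 0 < (1 - (n : ℝ)⁻¹) * (1 - 2 * (n : ℝ)⁻¹) := by
    intro n hn
    have hn3 : (3 : ℝ) ≤ n := by exact_mod_cast hn
    have h : (n : ℝ)⁻¹ ≤ 3⁻¹ := inv_anti₀ (by norm_num) hn3
    exact mul_pos (by linarith) (by linarith)
  refine tendsto_order.mpr ⟨fun a ha => ?_, fun a ha => ?_⟩
  · have hlow : Tendsto (fun n : ℕ => 2 / 9 * (1 - 5 * (n : ℝ)⁻¹) ^ 3) atTop (𝓝 (2 / 9)) := by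
      have h := ((tendsto_const_nhds (x := (1 : ℝ))).sub (hinv.const_mul 5)).pow 3
      simpa using h.const_mul (2 / 9)
    filter_upwards [(tendsto_order.mp hlow).1 a ha, eventually_ge_atTop 5] with n hna hn
    refine hna.trans_le ?_
    have hn0 : (0 : ℝ) < n := by positivity
    have hc : (0 : ℝ) < n.choose 3 := by exact_mod_cast Nat.choose_pos (by omega)
    have hc' : (n.choose 3 : ℝ) ≤ (n : ℝ) ^ 3 / 6 := by
      rw [choose_three_eq]
      have : (5 : ℝ) ≤ n := by exact_mod_cast hn
      nlinarith [mul_nonneg hn0.le (sub_nonneg.mpr this)]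
    rw [le_div_iff₀ hc]
    have hdiv : ((n : ℝ) - 5) / 6 ≤ ((n / 6 : ℕ) : ℝ) := by
      have h : n ≤ 6 * (n / 6) + 5 := by omega
      have h' : (n : ℝ) ≤ 6 * ((n / 6 : ℕ) : ℝ) + 5 := by exact_mod_cast h
      linarith
    have hn5 : (0 : ℝ) ≤ n - 5 := by
      have : (5 : ℝ) ≤ n := by exact_mod_cast hn
      linarith
    have hfac : (0 : ℝ) ≤ 1 - 5 * (n : ℝ)⁻¹ := by
      have : 1 - 5 * (n : ℝ)⁻¹ = (n - 5) / n := by field_simp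
      rw [this]; positivity
    calc 2 / 9 * (1 - 5 * (n : ℝ)⁻¹) ^ 3 * (n.choose 3 : ℝ)
        ≤ 2 / 9 * (1 - 5 * (n : ℝ)⁻¹) ^ 3 * ((n : ℝ) ^ 3 / 6) := by gcongr
      _ = 8 * (((n : ℝ) - 5) / 6) ^ 3 := by field_simp; ring
      _ ≤ 8 * ((n / 6 : ℕ) : ℝ) ^ 3 := by gcongr
      _ ≤ (productF.turanNumber n : ℝ) := by exact_mod_cast eight_mul_pow_le_turanNumber n
  · obtain ⟨η, hη, hηa⟩ : ∃ η : ℝ, 0 < η ∧ 2 / 9 + η < a :=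
      ⟨(a - 2 / 9) / 2, by linarith, by linarith⟩
    obtain ⟨n₀, hn₀⟩ := RGraph.card_edges_le_of_isFree hη
    have hup : Tendsto (fun n : ℕ =>
        (2 / 9 + η) * ((1 - (n : ℝ)⁻¹) * (1 - 2 * (n : ℝ)⁻¹))⁻¹) atTop (𝓝 (2 / 9 + η)) := by
      simpa using hnorm.const_mul (2 / 9 + η)
    filter_upwards [(tendsto_order.mp hup).2 a hηa, eventually_ge_atTop (max n₀ 3)] with n hna hn
    refine lt_of_le_of_lt ?_ hna
    have hn3 : 3 ≤ n := (le_max_right _ _).trans hn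
    have hturan : (productF.turanNumber n : ℝ) ≤ (2 / 9 + η) * ((n : ℝ) ^ 3 / 6) := by
      refine RGraph.turanNumber_le (by positivity) fun H hH => ?_
      have := hn₀ n ((le_max_left _ _).trans hn) H hH
      linarith
    have hp := hpos n hn3
    have hn0 : (0 : ℝ) < n := by positivity
    rw [hchoose n hn3, div_le_iff₀ (by positivity)]
    refine hturan.trans (le_of_eq ?_)
    generalize (1 - (n : ℝ)⁻¹) * (1 - 2 * (n : ℝ)⁻¹) = d at hp
    field_simp

/-! ### A count that is robust under edits -/

section PairCount

/-- The number of ordered pairs of edges with a marked common pair of vertices: the sum of the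
squares of the codegrees of all ordered pairs of vertices. -/
def sumSqCodegree {V : Type*} [Fintype V] [DecidableEq V] (E : Finset (Finset V)) : ℕ :=
  (Finset.univ.filter fun p : V × V × V × V =>
    {p.1, p.2.1, p.2.2.1} ∈ E ∧ {p.1, p.2.1, p.2.2.2} ∈ E).card

variable {V W : Type*} [Fintype V] [DecidableEq V] [Fintype W] [DecidableEq W]

lemma sumSqCodegree_image (σ : V ≃ W) (E : Finset (Finset V)) :
    sumSqCodegree (E.image (Finset.image σ)) = sumSqCodegree E := by
  have hmem : ∀ x y z : V, {σ x, σ y, σ z} ∈ E.image (Finset.image σ) ↔ {x, y, z} ∈ E := by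
    intro x y z
    have h : ({σ x, σ y, σ z} : Finset W) = Finset.image σ {x, y, z} := by
      simp [Finset.image_insert]
    rw [h, (Finset.image_injective σ.injective).mem_finset_image]
  symm
  refine Finset.card_equiv (σ.prodCongr (σ.prodCongr (σ.prodCongr σ))) ?_
  rintro ⟨x, y, z, z'⟩
  simp only [Finset.mem_filter, Finset.mem_univ, true_and, Equiv.prodCongr_apply, Prod.map, hmem]

/-- Each missing edge destroys at most `54 |V|` of the counted configurations. -/
lemma sumSqCodegree_le {E E' : Finset (Finset V)} (hE : ∀ e ∈ E, e.card = 3) :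
    sumSqCodegree E ≤ sumSqCodegree E' + 54 * Fintype.card V * (E \ E').card := by
  have hsub : (Finset.univ.filter fun p : V × V × V × V =>
      {p.1, p.2.1, p.2.2.1} ∈ E ∧ {p.1, p.2.1, p.2.2.2} ∈ E) ⊆
      (Finset.univ.filter fun p : V × V × V × V =>
        {p.1, p.2.1, p.2.2.1} ∈ E' ∧ {p.1, p.2.1, p.2.2.2} ∈ E') ∪
      ((E \ E').biUnion (fun e => e ×ˢ e ×ˢ e ×ˢ Finset.univ) ∪
        (E \ E').biUnion (fun e => e ×ˢ e ×ˢ Finset.univ ×ˢ e)) := by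
    rintro ⟨x, y, z, z'⟩ hp
    simp only [Finset.mem_filter, Finset.mem_univ, true_and] at hp
    simp only [Finset.mem_union, Finset.mem_filter, Finset.mem_univ, true_and, Finset.mem_biUnion,
      Finset.mem_product, and_true]
    by_cases h₁ : {x, y, z} ∈ E'
    · by_cases h₂ : {x, y, z'} ∈ E'
      · exact Or.inl ⟨h₁, h₂⟩
      · exact Or.inr (Or.inr ⟨{x, y, z'}, Finset.mem_sdiff.mpr ⟨hp.2, h₂⟩, by simp⟩)
    · exact Or.inr (Or.inl ⟨{x, y, z}, Finset.mem_sdiff.mpr ⟨hp.1, h₁⟩, by simp⟩)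
  have hb₁ : ((E \ E').biUnion (fun e => e ×ˢ e ×ˢ e ×ˢ (Finset.univ : Finset V))).card ≤
      (E \ E').card * (27 * Fintype.card V) := by
    refine Finset.card_biUnion_le_card_mul _ _ _ fun e he => ?_
    simp only [Finset.card_product, hE e (Finset.mem_sdiff.mp he).1, Finset.card_univ]
    omega
  have hb₂ : ((E \ E').biUnion (fun e => e ×ˢ e ×ˢ (Finset.univ : Finset V) ×ˢ e)).card ≤
      (E \ E').card * (27 * Fintype.card V) := by
    refine Finset.card_biUnion_le_card_mul _ _ _ fun e he => ?_
    simp only [Finset.card_product, hE e (Finset.mem_sdiff.mp he).1, Finset.card_univ]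
    omega
  have h := (Finset.card_le_card hsub).trans ((Finset.card_union_le _ _).trans
    (Nat.add_le_add_left ((Finset.card_union_le _ _).trans (Nat.add_le_add hb₁ hb₂)) _))
  unfold sumSqCodegree
  refine h.trans (le_of_eq ?_)
  ring

lemma sumSqCodegree_eq_sum (E : Finset (Finset V)) :
    sumSqCodegree E = ∑ x, ∑ y, (∑ z, if {x, y, z} ∈ E then 1 else 0) ^ 2 := by
  unfold sumSqCodegree
  rw [Finset.card_filter]
  simp only [Fintype.sum_prod_type, sq, Finset.sum_mul_sum]
  refine Finset.sum_congr rfl fun x _ => Finset.sum_congr rfl fun y _ =>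
    Finset.sum_congr rfl fun z _ => Finset.sum_congr rfl fun z' _ => ?_
  split_ifs <;> simp_all

/-- Two `3`-graphs that are close, after relabelling, to a common `3`-graph have close counts. -/
lemma sumSqCodegree_le_of_editCount {n : ℕ} {H₁ H₂ G : RGraph 3 (Fin n)}
    {σ₁ σ₂ : Equiv.Perm (Fin n)} :
    sumSqCodegree H₁.edges ≤ sumSqCodegree H₂.edges +
      54 * n * (RGraph.editCount σ₁ H₁ G + RGraph.editCount σ₂ H₂ G) := by
  have hcard : ∀ e ∈ H₁.edges.image (Finset.image σ₁), e.card = 3 := by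
    intro e he
    obtain ⟨e', he', rfl⟩ := Finset.mem_image.mp he
    rw [Finset.card_image_of_injective _ σ₁.injective, H₁.card_eq e' he']
  have h₁ := sumSqCodegree_le (E' := G.edges) hcard
  have h₂ := sumSqCodegree_le (E' := H₂.edges.image (Finset.image σ₂)) G.card_eq
  rw [sumSqCodegree_image] at h₁ h₂
  rw [Fintype.card_fin] at h₁ h₂
  have d₁ : (H₁.edges.image (Finset.image σ₁) \ G.edges).card ≤ RGraph.editCount σ₁ H₁ G :=
    Finset.card_le_card (by
      rw [symmDiff_def]; exact Finset.subset_union_left)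
  have d₂ : (G.edges \ H₂.edges.image (Finset.image σ₂)).card ≤ RGraph.editCount σ₂ H₂ G :=
    Finset.card_le_card (by
      rw [symmDiff_def]; exact Finset.subset_union_right)
  calc sumSqCodegree H₁.edges
      ≤ sumSqCodegree H₂.edges + 54 * n * (G.edges \ H₂.edges.image (Finset.image σ₂)).card +
        54 * n * (H₁.edges.image (Finset.image σ₁) \ G.edges).card := by linarith
    _ ≤ sumSqCodegree H₂.edges + 54 * n * RGraph.editCount σ₂ H₂ G +
        54 * n * RGraph.editCount σ₁ H₁ G := by gcongr
    _ = _ := by ring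

end PairCount

section TwoCutsCount

variable {N j : ℕ}

lemma codegree_inl_inr (w : Fin (2 * N)) (u : Bool × Bool × Fin N) :
    (∑ z, if {Sum.inl w, Sum.inr u, z} ∈ (twoCuts N j).edges then 1 else 0) = 2 * N := by
  have h₀ : ∀ w' : Fin (2 * N), {Sum.inl w, Sum.inr u, Sum.inl w'} ∉ (twoCuts N j).edges := by
    intro w'
    rw [Finset.pair_comm]
    exact inl_inl_notMem_twoCuts_edges
  simp only [Fintype.sum_sum_type, h₀, if_false, Finset.sum_const_zero, zero_add,
    inl_inr_inr_mem_twoCuts_edges]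
  rw [← card_filter_cutSide w (!cutSide j w u), Finset.card_filter]
  refine Finset.sum_congr rfl fun u' _ => ?_
  cases cutSide j w u <;> cases cutSide j w u' <;> simp

lemma codegree_inr_inl (w : Fin (2 * N)) (u : Bool × Bool × Fin N) :
    (∑ z, if {Sum.inr u, Sum.inl w, z} ∈ (twoCuts N j).edges then 1 else 0) = 2 * N := by
  refine (Finset.sum_congr rfl fun z _ => ?_).trans (codegree_inl_inr (j := j) w u)
  rw [Finset.insert_comm]

lemma codegree_inl_inl (w w' : Fin (2 * N)) :
    (∑ z, if {Sum.inl w, Sum.inl w', z} ∈ (twoCuts N j).edges then 1 else 0) = 0 :=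
  Finset.sum_eq_zero fun _ _ => if_neg inl_inl_notMem_twoCuts_edges

lemma codegree_inr_inr (hj : j ≤ 2 * N) (u u' : Bool × Bool × Fin N) :
    (∑ z, if {Sum.inr u, Sum.inr u', z} ∈ (twoCuts N j).edges then 1 else 0) =
      (if u.1 ≠ u'.1 then j else 0) + if u.2.1 ≠ u'.2.1 then 2 * N - j else 0 := by
  have h₀ : ∀ w : Fin (2 * N), {Sum.inr u, Sum.inr u', Sum.inl w} ∈ (twoCuts N j).edges ↔
      cutSide j w u ≠ cutSide j w u' := by
    intro w
    rw [Finset.pair_comm, Finset.insert_comm]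
    exact inl_inr_inr_mem_twoCuts_edges
  simp only [Fintype.sum_sum_type, h₀, inr_inr_inr_notMem_twoCuts_edges, if_false,
    Finset.sum_const_zero, add_zero]
  have hlt : (∑ w : Fin (2 * N), if (w : ℕ) < j then 1 else 0) = j := by
    rw [Fin.sum_univ_eq_sum_range (fun w => if w < j then 1 else 0), ← Finset.card_filter]
    have : (Finset.range (2 * N)).filter (fun w => w < j) = Finset.range j := by
      ext w; simp; omega
    rw [this, Finset.card_range]
  have hge : (∑ w : Fin (2 * N), if (w : ℕ) < j then 0 else 1) = 2 * N - j := by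
    have h : (∑ w : Fin (2 * N), if (w : ℕ) < j then 1 else 0) +
        (∑ w : Fin (2 * N), if (w : ℕ) < j then 0 else 1) = 2 * N := by
      rw [← Finset.sum_add_distrib]
      have : ∀ w : Fin (2 * N),
          ((if (w : ℕ) < j then 1 else 0) + if (w : ℕ) < j then 0 else 1) = 1 := by
        intro w; split_ifs <;> rfl
      simp [this]
    omega
  calc (∑ w : Fin (2 * N), if cutSide j w u ≠ cutSide j w u' then 1 else 0)
      = ∑ w : Fin (2 * N), ((if u.1 ≠ u'.1 then 1 else 0) * (if (w : ℕ) < j then 1 else 0) +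
          (if u.2.1 ≠ u'.2.1 then 1 else 0) * (if (w : ℕ) < j then 0 else 1)) := by
        refine Finset.sum_congr rfl fun w _ => ?_
        unfold cutSide
        by_cases h : (w : ℕ) < j <;> simp [h]
    _ = _ := by
        rw [Finset.sum_add_distrib, ← Finset.mul_sum, ← Finset.mul_sum, hlt, hge]
        split_ifs <;> simp

/-- The count depends on `j`: the pairs of vertices of `U` separated by both bipartitions have
codegree `2N`, those separated by one of them have codegree `j` or `2N - j`. -/
lemma sumSqCodegree_twoCuts (hj : j ≤ 2 * N) :
    sumSqCodegree (twoCuts N j).edges =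
      64 * N ^ 4 + 4 * N ^ 2 * (j ^ 2 + (2 * N - j) ^ 2 + (2 * N) ^ 2) := by
  rw [sumSqCodegree_eq_sum]
  have h₁ := codegree_inl_inl (N := N) (j := j)
  have h₂ := codegree_inl_inr (N := N) (j := j)
  have h₃ := codegree_inr_inl (N := N) (j := j)
  have h₄ := codegree_inr_inr hj
  have hk : j + (2 * N - j) = 2 * N := Nat.add_sub_cancel' hj
  generalize 2 * N - j = k at h₄ hk ⊢
  generalize hd : (fun x y => ∑ z, if {x, y, z} ∈ (twoCuts N j).edges then 1 else 0) = d
  have hd' : ∀ x y, (∑ z, if {x, y, z} ∈ (twoCuts N j).edges then 1 else 0) = d x y :=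
    fun x y => congrFun (congrFun hd x) y
  simp only [hd'] at h₁ h₂ h₃ h₄ ⊢
  simp only [Fintype.sum_sum_type, h₁, h₂, h₃, h₄]
  simp [Fintype.sum_prod_type]
  zify at hk ⊢
  linear_combination 4 * (N : ℤ) ^ 2 * (j + k + 2 * N) * hk

end TwoCutsCount

/-! ### Instability -/

/-- For `j ≤ N` the counts of the two-bipartition `3`-graphs are separated. -/
lemma sumSqCodegree_twoCuts_gap {s a b c : ℕ} (hab : a < b) (hbc : b < c) :
    sumSqCodegree (twoCuts (c * s) (b * s)).edges + 8 * (c * s) ^ 2 * s ^ 2 ≤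
      sumSqCodegree (twoCuts (c * s) (a * s)).edges := by
  obtain ⟨k, rfl⟩ := Nat.exists_eq_add_of_lt hab
  obtain ⟨l, rfl⟩ := Nat.exists_eq_add_of_lt hbc
  rw [sumSqCodegree_twoCuts (by nlinarith), sumSqCodegree_twoCuts (by nlinarith)]
  have e₁ : 2 * ((a + k + 1 + l + 1) * s) - (a + k + 1) * s = (a + k + 1 + 2 * l + 2) * s := by
    rw [Nat.sub_eq_iff_eq_add (by nlinarith)]; ring
  have e₂ : 2 * ((a + k + 1 + l + 1) * s) - a * s = (a + 2 * k + 2 * l + 4) * s := by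
    rw [Nat.sub_eq_iff_eq_add (by nlinarith)]; ring
  rw [e₁, e₂]
  have key : ((a + k + 1) * s) ^ 2 + ((a + k + 1 + 2 * l + 2) * s) ^ 2 + 2 * s ^ 2 ≤
      (a * s) ^ 2 + ((a + 2 * k + 2 * l + 4) * s) ^ 2 := by
    have : (a + k + 1) ^ 2 + (a + k + 1 + 2 * l + 2) ^ 2 + 2 ≤
      a ^ 2 + (a + 2 * k + 2 * l + 4) ^ 2 := by nlinarith
    nlinarith [Nat.mul_le_mul_right (s ^ 2) this]
  nlinarith [Nat.mul_le_mul_left (4 * ((a + k + 1 + l + 1) * s) ^ 2) key]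

theorem not_isStable_productF (t : ℕ) : ¬ productF.IsStable t := by
  rintro ⟨G, hG⟩
  -- For `n = 6N` with `N = (t + 1) s`, two relabellings within `δ n ^ 3` edits of a common model
  -- have counts differing by at most `108 δ n ^ 4 < 8 N ^ 2 s ^ 2`, while distinct values of `j`
  -- give counts that differ by at least `8 N ^ 2 s ^ 2`.
  obtain ⟨ε, hε, N₀, hstab⟩ := hG (1 / (20000 * ((t : ℝ) + 1) ^ 2)) (by positivity)
  have hev : ∀ᶠ n : ℕ in atTop,
      (1 - ε) * ((productF.turanNumber n : ℝ) / (n.choose 3 : ℝ)) < 2 / 9 := by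
    have h := hasTuranDensity_productF.const_mul (1 - ε)
    exact (tendsto_order.mp h).2 _ (by linarith)
  obtain ⟨N₁, hN₁⟩ := eventually_atTop.mp hev
  obtain ⟨s, hs⟩ : ∃ s : ℕ, s = max (max N₀ N₁) 3 := ⟨_, rfl⟩
  have hs₀ : N₀ ≤ s ∧ N₁ ≤ s ∧ 3 ≤ s := by omega
  obtain ⟨N, hN⟩ : ∃ N : ℕ, N = (t + 1) * s := ⟨_, rfl⟩
  have hsN : s ≤ N := by rw [hN]; nlinarith
  let e : (Fin (2 * N) ⊕ Bool × Bool × Fin N) ≃ Fin (6 * N) :=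
    Fintype.equivFinOfCardEq (card_twoCuts_vertices N)
  let H : ℕ → RGraph 3 (Fin (6 * N)) := fun j => RGraph.map e.toEmbedding (twoCuts N j)
  have hfree : ∀ j, (H j).IsFree productF := by
    intro j
    have : Nonempty (Fin (2 * N)) := ⟨⟨0, by omega⟩⟩
    exact RGraph.isFree_map_of_not_isHom (not_isHom_productF_twoCuts N j) _
  have hcard : ∀ j, (H j).edges.card = 8 * N ^ 3 := fun j =>
    (RGraph.card_map_edges _ _).trans (card_twoCuts_edges N j)
  have hcount : ∀ j, sumSqCodegree (H j).edges = sumSqCodegree (twoCuts N j).edges := fun j =>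
    sumSqCodegree_image e _
  have hN3 : (3 : ℝ) ≤ N := by exact_mod_cast (by omega : 3 ≤ N)
  have hdense : ∀ j, (1 - ε) * (productF.turanNumber (6 * N) : ℝ) < ((H j).edges.card : ℝ) := by
    intro j
    have h := hN₁ (6 * N) (by omega)
    have hc : (0 : ℝ) < (6 * N).choose 3 := by exact_mod_cast Nat.choose_pos (by omega)
    rw [← mul_div_assoc, div_lt_iff₀ hc, choose_three_eq] at h
    rw [hcard]
    push_cast at h ⊢
    nlinarith
  have hnear := fun j => hstab (6 * N) (by omega) (H j) (hfree j) (hdense j)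
  choose i σ hi using hnear
  -- Among `t + 1` values of `j` two are near the same model.
  obtain ⟨a, b, hab, hiab⟩ : ∃ a b : Fin (t + 1), a < b ∧ i (a * s) = i (b * s) := by
    obtain ⟨a, b, hne, heq⟩ := Fintype.exists_ne_map_eq_of_card_lt
      (fun a : Fin (t + 1) => i (a * s)) (by simp)
    rcases lt_or_gt_of_ne hne with h | h
    · exact ⟨a, b, h, heq⟩
    · exact ⟨b, a, h, heq.symm⟩
  have ha := hi (a * s)
  have hb := hi (b * s)
  rw [hiab] at ha
  have hle := sumSqCodegree_le_of_editCount (H₁ := H (a * s)) (H₂ := H (b * s))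
    (G := G (i (b * s)) (6 * N)) (σ₁ := σ (a * s)) (σ₂ := σ (b * s))
  have hgap := sumSqCodegree_twoCuts_gap (s := s) (show (a : ℕ) < b from hab)
    (show (b : ℕ) < t + 1 from b.2)
  rw [← hN, ← hcount, ← hcount] at hgap
  have hfinal := hgap.trans hle
  have hfinal' : (8 * N ^ 2 * s ^ 2 : ℕ) ≤ 54 * (6 * N) *
      (RGraph.editCount (σ (a * s)) (H (a * s)) (G (i (b * s)) (6 * N)) +
        RGraph.editCount (σ (b * s)) (H (b * s)) (G (i (b * s)) (6 * N))) := by omega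
  have hreal : (8 * (N : ℝ) ^ 2 * (s : ℝ) ^ 2) ≤ 54 * (6 * N) *
      ((RGraph.editCount (σ (a * s)) (H (a * s)) (G (i (b * s)) (6 * N)) : ℝ) +
        (RGraph.editCount (σ (b * s)) (H (b * s)) (G (i (b * s)) (6 * N)) : ℝ)) := by
    exact_mod_cast hfinal'
  have hNr : (N : ℝ) = (t + 1) * s := by rw [hN]; push_cast; ring
  have hspos : (0 : ℝ) < s := by exact_mod_cast (by omega : 0 < s)
  have hδ : 1 / (20000 * ((t : ℝ) + 1) ^ 2) * ((6 * N : ℕ) : ℝ) ^ 3 =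
      216 / 20000 * N * (s : ℝ) ^ 2 := by
    push_cast
    rw [hNr]
    field_simp
    ring
  rw [hδ] at ha hb
  have hNpos : (0 : ℝ) < N := by linarith
  have h₁ : 8 * (N : ℝ) ^ 2 * (s : ℝ) ^ 2 ≤
      54 * (6 * N) * (216 / 20000 * N * (s : ℝ) ^ 2 + 216 / 20000 * N * (s : ℝ) ^ 2) :=
    hreal.trans (mul_le_mul_of_nonneg_left (add_le_add ha hb) (by positivity))
  have h₂ : (0 : ℝ) < (N : ℝ) ^ 2 * (s : ℝ) ^ 2 := by positivity
  nlinarith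

theorem theorem1 :
    Fintype.card (Fin 4 × Fin 7) = 28 ∧
    productF.edges.card = 90 ∧
    productF.HasTuranDensity (2 / 9) ∧
    productF.stabilityNumber = ⊤ := by
  refine ⟨by simp, card_productF_edges, hasTuranDensity_productF, ?_⟩
  unfold RGraph.stabilityNumber
  refine sInf_eq_top.mpr ?_
  rintro s ⟨t, ht, -⟩
  exact absurd ht (not_isStable_productF t)
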